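/- Consider a synchronous multi-code CDMA system with processing gain $N\ge 1$, users $k=1,\dots,K$ with powers $p_k>0$ and at most $\bar n_k\ge 1$ data streams each, and white Gaussian noise of variance $\sigma^2>0$ per dimension. A feasible power distribution is a family $(p_{k,l})$, $1\le l\le \bar n_k$, with $p_{k,l}\ge 0$ and $\sum_l p_{k,l}=p_k$ for all $k$. The pair $(k,l)$ is called a virtual single-code user; it is active if $p_{k,l}>0$. Every active virtual user has a signature sequence $s_{k,l}\in\mathbb R^N$ with $\|s_{k,l}\|^2=N$; the sequences of inactive virtual users are arbitrary and play no role. The sum rate is $$\frac1{2N}\log_2\det\Big(I_N+\frac1{\sigma^2}\sum_{k,l}p_{k,l}\,s_{k,l}s_{k,l}^T\Big).$$ A power distribution is optimal if it maximizes, among all feasible power distributions, the maximum of the sum rate over the signature sequences. Number the active virtual users, for a given power distribution, in a non-increasing order $q_1\ge q_2\ge\dots\ge q_m>0$ of their powers. The $i$-th one is oversized, critically-sized or undersized if $$\hat w_i=\Big(\frac12-\frac{i-1}{2N}\Big)\frac{q_i}{\sum_{j\ge i}q_j}$$ is greater than, equal to, or less than $\frac1{2N}$, respectively. Let $\mathcal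 K_2$ be the set of all active virtual users that are not undersized. Theorem. Optimal power distributions exist. Let $(p^*_{k,l})$ be one of them, and let $\mathcal K_2$ be formed with respect to it (for any numbering as above). Then $|\mathcal K_2|\le N$, and signature sequences $(s_{k,l})$ maximize the sum rate jointly with $(p^*_{k,l})$, that is, over all feasible power distributions and all signature sequences, if and only if they have the following form: (i) the vectors $s_{k,l}$, $(k,l)\in\mathcal K_2$, are mutually orthogonal with $\|s_{k,l}\|^2=N$; (ii) there is an $N\times(N-|\mathcal K_2|)$ matrix $E$ whose columns are mutually orthogonal, have squared norm $N$, and form a basis of the orthogonal complement of the span of $\{s_{k,l}:(k,l)\in\mathcal K_2\}$, such that every active virtual user $(k,l)\notin\mathcal K_2$ has $s_{k,l}=E\tilde s_{k,l}$, where the $\tilde s_{k,l}\in\mathbb R^{N-|\mathcal K_2|}$ are generalized Welch-bound-equality (GWBE) sequences, i.e., unit vectors with $$\sum_{(k,l)\notin\mathcal K_2,\;p^*_{k,l}>0}p^*_{k,l}\,\tilde s_{k,l}\tilde s_{k,l}^{T}=\frac{\sum_{(k,l)\notin\mathcal K_2}p^*_{k,l}}{N-|\mathcal K_2|}\,I_{N-|\mathcal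 K_2|}.$$ Moreover, signature sequences of this form exist. (If $|\mathcal K_2|=N$, there is no active virtual user outside $\mathcal K_2$, and (ii) is empty.) -/

import Mathlib

/-! ### User classification in a bandwidth-restricted FDMA system -/

/-- The users of an FDMA system with powers `p` and bandwidth upper limits `wbar` are numbered in a
non-increasing order of their minimal power spectral densities `p k / wbar k`. -/
def FDMA.IsOrdered {n : ℕ} (p wbar : Fin n → ℝ) : Prop :=
  Antitone fun k => p k / wbar k

/-- The due share `ŵ_k` of the `k`th user: the proportional share of the bandwidth that is left when
all the users before `k` have received their upper limits. -/
noncomputable def FDMA.dueShare {n : ℕ} (p wbar : Fin n → ℝ) (wtot : ℝ) (k : Fin n) : ℝ :=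
  (wtot - ∑ j ∈ Finset.Iio k, wbar j) * (p k / ∑ j ∈ Finset.Ici k, p j)

/-- The `k`th user is undersized if `ŵ_k < wbar k` (critically-sized if `ŵ_k = wbar k`, oversized if
`ŵ_k > wbar k`). -/
def FDMA.IsUndersized {n : ℕ} (p wbar : Fin n → ℝ) (wtot : ℝ) (k : Fin n) : Prop :=
  FDMA.dueShare p wbar wtot k < wbar k

/-! ### The multi-code CDMA system -/

/-- The virtual single-code users `(k, l)`, `1 ≤ k ≤ K`, `1 ≤ l ≤ nbar k`. -/
abbrev VirtualUser {K : ℕ} (nbar : Fin K → ℕ) : Type := Σ k : Fin K, Fin (nbar k)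

/-- `P` distributes the power `p k` of every multi-code user `k` to its data streams. -/
def IsFeasiblePower {K : ℕ} {nbar : Fin K → ℕ} (p : Fin K → ℝ) (P : VirtualUser nbar → ℝ) : Prop :=
  (∀ k, ∑ l, P ⟨k, l⟩ = p k) ∧ ∀ v, 0 ≤ P v

/-- The signature sequence (a column of `S`) of every active stream has energy (squared Euclidean
norm) `N`. A stream of zero power is not transmitted, so that its column is immaterial. -/
def IsAdmissible {K : ℕ} {nbar : Fin K → ℕ} (N : ℕ) (P : VirtualUser nbar → ℝ)
    (S : Matrix (Fin N) (VirtualUser nbar) ℝ) : Prop :=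
  ∀ v, 0 < P v → S.col v ⬝ᵥ S.col v = (N : ℝ)

/-- The sum rate `(1 / 2N) log₂ det (I + σ⁻² S P Sᵀ)` in bits per chip. -/
noncomputable def sumRate {K : ℕ} {nbar : Fin K → ℕ} (N : ℕ) (σ : ℝ) (P : VirtualUser nbar → ℝ)
    (S : Matrix (Fin N) (VirtualUser nbar) ℝ) : ℝ :=
  1 / (2 * (N : ℝ)) *
    Real.logb 2 (1 + (1 / σ ^ 2) • (S * Matrix.diagonal P * S.transpose)).det

/-- The largest sum rate for given stream powers `P` (the inner optimization). -/
noncomputable def maxSumRate {K : ℕ} {nbar : Fin K → ℕ} (N : ℕ) (σ : ℝ)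
    (P : VirtualUser nbar → ℝ) : ℝ :=
  sSup {r | ∃ S, IsAdmissible N P S ∧ r = sumRate N σ P S}

/-- `P` is an optimal power distribution (the outer optimization). -/
def IsOptimalPower {K : ℕ} {nbar : Fin K → ℕ} (N : ℕ) (σ : ℝ) (p : Fin K → ℝ)
    (P : VirtualUser nbar → ℝ) : Prop :=
  IsFeasiblePower p P ∧ ∀ P' : VirtualUser nbar → ℝ,
    IsFeasiblePower p P' → maxSumRate N σ P' ≤ maxSumRate N σ P

/-- `(P, S)` maximizes the sum rate jointly over all power distributions and all signature
sequences. -/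
def IsOptimalSystem {K : ℕ} {nbar : Fin K → ℕ} (N : ℕ) (σ : ℝ) (p : Fin K → ℝ)
    (P : VirtualUser nbar → ℝ) (S : Matrix (Fin N) (VirtualUser nbar) ℝ) : Prop :=
  (IsFeasiblePower p P ∧ IsAdmissible N P S) ∧
    ∀ (P' : VirtualUser nbar → ℝ) (S' : Matrix (Fin N) (VirtualUser nbar) ℝ),
      IsFeasiblePower p P' → IsAdmissible N P' S' → sumRate N σ P' S' ≤ sumRate N σ P S

/-! ### Classification of the active virtual users -/

/-- `e` numbers the active virtual users as the FDMA classification requires, every one of them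
having the bandwidth upper limit `1 / (2N)`; that is, in a non-increasing order of power. -/
def IsPowerNumbering {K : ℕ} {nbar : Fin K → ℕ} (N : ℕ) (P : VirtualUser nbar → ℝ) {m : ℕ}
    (e : Fin m ≃ {v // 0 < P v}) : Prop :=
  FDMA.IsOrdered (fun i => P (e i)) (fun _ => 1 / (2 * (N : ℝ)))

open Classical in
/-- The set of the active virtual users that are not undersized in the FDMA system with the powers
of the active virtual users, the bandwidth upper limits `1 / (2N)` and the total bandwidth `1 / 2`.
-/
noncomputable def nonUndersized {K : ℕ} {nbar : Fin K → ℕ} (N : ℕ) (P : VirtualUser nbar → ℝ)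
    {m : ℕ} (e : Fin m ≃ {v // 0 < P v}) : Finset (VirtualUser nbar) :=
  (Finset.univ.filter fun i : Fin m =>
    ¬ FDMA.IsUndersized (fun j => P (e j)) (fun _ => 1 / (2 * (N : ℝ))) (1 / 2) i).map
      (e.toEmbedding.trans (Function.Embedding.subtype _))

/-- A power numbering exists for all stream powers. -/
theorem exists_isPowerNumbering {K : ℕ} {nbar : Fin K → ℕ} (N : ℕ) (P : VirtualUser nbar → ℝ) :
    ∃ (m : ℕ) (e : Fin m ≃ {v // 0 < P v}), IsPowerNumbering N P e := by
  classical
  let e₀ := (Fintype.equivFin {v // 0 < P v}).symm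
  let f : Fin (Fintype.card {v // 0 < P v}) → ℝ := fun i => -P (e₀ i)
  refine ⟨_, (Tuple.sort f).trans e₀, ?_⟩
  intro i j hij
  have h := Tuple.monotone_sort f hij
  simp only [f, Function.comp_apply, neg_le_neg_iff] at h
  simp only [Equiv.trans_apply]
  gcongr

/-! ### The form of the optimal signature sequences -/

/-- The vectors `s v`, `v ∈ A`, are generalized Welch-bound-equality (GWBE) sequences of length `d`
for the powers `P v`: unit vectors with `∑ P v • (s v) (s v)ᵀ = ((∑ P v) / d) • I`. -/
def IsGWBE {ι : Type*} {d : ℕ} (A : Finset ι) (P : ι → ℝ) (s : ι → Fin d → ℝ) : Prop :=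
  (∀ v ∈ A, s v ⬝ᵥ s v = 1) ∧
    ∑ v ∈ A, P v • Matrix.vecMulVec (s v) (s v) =
      ((∑ v ∈ A, P v) / (d : ℝ)) • (1 : Matrix (Fin d) (Fin d) ℝ)

/-- The columns of `E` are orthogonal vectors of squared norm `N` that form a basis of the orthogonal
complement of the span of the columns `v ∈ A` of `S`. -/
def IsComplementBasis {ι : Type*} {N d : ℕ} (A : Finset ι) (S : Matrix (Fin N) ι ℝ)
    (E : Matrix (Fin N) (Fin d) ℝ) : Prop :=
  E.transpose * E = (N : ℝ) • (1 : Matrix (Fin d) (Fin d) ℝ) ∧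
    ∀ x : Fin N → ℝ,
      x ∈ Submodule.span ℝ (Set.range E.col) ↔ ∀ v ∈ A, S.col v ⬝ᵥ x = 0

open Classical in
/-- The users in `A` have mutually orthogonal sequences of squared norm `N`, and the other active
users have sequences `E s̃` with GWBE sequences `s̃` of length `N - |A|`, where the columns of `E`
are a basis of the orthogonal complement. -/
def IsOrthogonalGWBE {K : ℕ} {nbar : Fin K → ℕ} (N : ℕ) (P : VirtualUser nbar → ℝ)
    (A : Finset (VirtualUser nbar)) (S : Matrix (Fin N) (VirtualUser nbar) ℝ) : Prop :=
  (∀ v ∈ A, S.col v ⬝ᵥ S.col v = (N : ℝ)) ∧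
  (∀ v ∈ A, ∀ w ∈ A, v ≠ w → S.col v ⬝ᵥ S.col w = 0) ∧
  ∃ (E : Matrix (Fin N) (Fin (N - A.card)) ℝ) (s : VirtualUser nbar → Fin (N - A.card) → ℝ),
    IsComplementBasis A S E ∧
    (∀ v, v ∉ A → 0 < P v → S.col v = E.mulVec (s v)) ∧
    IsGWBE (Finset.univ.filter fun v => v ∉ A ∧ 0 < P v) P s

/-! Fix feasible powers. In suitable orthonormal coordinates the columns of the users in K₂ are
upper triangular (`exists_orthogonal_triangular`); let M be I + σ⁻² S P Sᵀ there. Compare M with the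
diagonal matrix of `extremalEigenvalues`: 1 + Nσ⁻²p for a user of power p in K₂, and a common value
1 + c on the other dimensions, where c spreads the remaining power evenly. Scaled on both sides by
the inverse square root of this matrix, M has trace at most N (`sum_div_extremalEigenvalues_le`).
Hence `Matrix.PosDef.det_le_one_of_trace_le` bounds det M by the product of these values, with
equality only if M equals the diagonal matrix. Equality then isolates the users of K₂ one after
another (`entry_eq_zero_of_eq_extremalEigenvalues`) and leaves the GWBE identity on the remaining
block (`IsPowerSplit.det_le`).

Conversely, every system of the stated form diagonalizes M and attains the bound. The classification
enters through `IsPowerSplit`: `rest_le` makes the bound work, and `le_rest` is the condition for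
GWBE sequences to exist, which are rescaled Parseval frames (`exists_parseval_frame`).

All this holds for any feasible powers. Optimality of the powers serves only to pass from the inner
maximum to the joint one, and maxima exist by compactness (`exists_isOptimalSystem`). -/

/-! ### Determinants of positive definite matrices -/

/-- A positive definite matrix whose trace is at most its size has determinant at most one, and it
is the identity matrix if its determinant is one. -/
theorem Matrix.PosDef.det_le_one_of_trace_le {κ : Type*} [Fintype κ] [DecidableEq κ]
    {B : Matrix κ κ ℝ} (hB : B.PosDef) (htr : B.trace ≤ Fintype.card κ) :
    B.det ≤ 1 ∧ (B.det = 1 → B = 1) := by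
  have hdet : B.det = ∏ i, hB.isHermitian.eigenvalues i := by
    simpa using hB.isHermitian.det_eq_prod_eigenvalues
  have htrace : B.trace = ∑ i, hB.isHermitian.eigenvalues i := by
    simpa using hB.isHermitian.trace_eq_sum_eigenvalues
  have hpos := hB.eigenvalues_pos
  -- The inequality x ≤ exp (x - 1), strict unless x = 1, plays the role of AM–GM: the exponentials
  -- multiply to exp (tr B - n).
  have hexp : ∏ i, Real.exp (hB.isHermitian.eigenvalues i - 1) ≤ 1 := by
    rw [← Real.exp_sum, Real.exp_le_one_iff]
    simp only [Finset.sum_sub_distrib, ← htrace]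
    simpa using htr
  have hle : ∀ i, hB.isHermitian.eigenvalues i ≤ Real.exp (hB.isHermitian.eigenvalues i - 1) := by
    intro i
    have := Real.add_one_le_exp (hB.isHermitian.eigenvalues i - 1)
    linarith
  refine ⟨?_, fun h1 => ?_⟩
  · rw [hdet]
    exact (Finset.prod_le_prod (fun i _ => (hpos i).le) fun i _ => hle i).trans hexp
  · have hone : ∀ i, hB.isHermitian.eigenvalues i = 1 := by
      by_contra! hne
      obtain ⟨i, hi⟩ := hne
      have hlt : hB.isHermitian.eigenvalues i < Real.exp (hB.isHermitian.eigenvalues i - 1) := by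
        have := Real.add_one_lt_exp (sub_ne_zero.2 hi)
        linarith
      have := Finset.prod_lt_prod (fun i _ => hpos i) (fun i _ => hle i)
        ⟨i, Finset.mem_univ i, hlt⟩
      linarith
    rw [hB.isHermitian.spectral_theorem]
    have : (RCLike.ofReal ∘ hB.isHermitian.eigenvalues : κ → ℝ) = 1 := by
      ext i
      simp [hone]
    rw [this, Pi.one_def, Matrix.diagonal_one, map_one]

theorem Matrix.mul_diagonal_mul_transpose_apply {κ κ' ι : Type*} [Fintype ι] [DecidableEq ι]
    (W : Matrix κ ι ℝ) (Q : ι → ℝ) (V : Matrix κ' ι ℝ) (i : κ) (j : κ') :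
    (W * Matrix.diagonal Q * V.transpose) i j = ∑ v, Q v * (W i v * V j v) := by
  rw [Matrix.mul_apply]
  refine Finset.sum_congr rfl fun v _ => ?_
  rw [Matrix.mul_diagonal, Matrix.transpose_apply]
  ring

theorem Matrix.posSemidef_mul_diagonal_mul_transpose {κ ι : Type*} [Fintype κ] [Fintype ι]
    [DecidableEq ι] (W : Matrix κ ι ℝ) {Q : ι → ℝ} (hQ : ∀ v, 0 ≤ Q v) :
    (W * Matrix.diagonal Q * W.transpose).PosSemidef := by
  have := (Matrix.PosSemidef.diagonal (R := ℝ) (d := Q) hQ).mul_mul_conjTranspose_same W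
  rwa [Matrix.conjTranspose_eq_transpose_of_trivial] at this

theorem Matrix.posDef_one_add_mul_diagonal_mul_transpose {κ ι : Type*} [Fintype κ]
    [DecidableEq κ] [Fintype ι] [DecidableEq ι] (W : Matrix κ ι ℝ) {Q : ι → ℝ}
    (hQ : ∀ v, 0 ≤ Q v) : (1 + W * Matrix.diagonal Q * W.transpose).PosDef :=
  Matrix.PosDef.one.add_posSemidef (W.posSemidef_mul_diagonal_mul_transpose hQ)

/-- The determinant of `1 + W Q Wᵀ` does not depend on the choice of orthonormal coordinates. -/
theorem Matrix.det_one_add_orthogonal_mul {κ κ' ι : Type*} [Fintype κ] [DecidableEq κ]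
    [Fintype κ'] [DecidableEq κ'] [Fintype ι] [DecidableEq ι] (U : Matrix κ κ' ℝ)
    (hU : U.transpose * U = 1) (S : Matrix κ' ι ℝ) (Q : ι → ℝ) :
    (1 + (U * S) * Matrix.diagonal Q * (U * S).transpose).det =
      (1 + S * Matrix.diagonal Q * S.transpose).det := by
  have h : (U * S) * Matrix.diagonal Q * (U * S).transpose =
      (U * (S * Matrix.diagonal Q * S.transpose)) * U.transpose := by
    simp only [Matrix.transpose_mul, Matrix.mul_assoc]
  rw [h, Matrix.det_one_add_mul_comm, ← Matrix.mul_assoc, hU, Matrix.one_mul]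

/-! ### The determinant bound in triangular coordinates -/

/-- The largest eigenvalues that `1 + W Q Wᵀ` can have if the columns of `W` have squared norm `L`:
the users `g i` have directions of their own, and the others share the remaining directions. -/
def extremalEigenvalues {ι : Type*} {k d : ℕ} (L c : ℝ) (Q : ι → ℝ) (g : Fin k → ι) :
    Fin k ⊕ Fin d → ℝ :=
  Sum.elim (fun i => 1 + L * Q (g i)) (fun _ => 1 + c)

theorem extremalEigenvalues_pos {ι : Type*} {k d : ℕ} {L c : ℝ} {Q : ι → ℝ} {g : Fin k → ι}
    (hL : 0 < L) (hQ : ∀ v, 0 ≤ Q v) (hc : 0 ≤ c)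
    (j : Fin k ⊕ Fin d) : 0 < extremalEigenvalues L c Q g j := by
  rcases j with i | a
  · have := mul_nonneg hL.le (hQ (g i))
    simp only [extremalEigenvalues, Sum.elim_inl]
    linarith
  · simp only [extremalEigenvalues, Sum.elim_inr]
    linarith

section TriangularBound

variable {ι : Type*} [Fintype ι] [DecidableEq ι] {k d : ℕ} {L c : ℝ} {Q : ι → ℝ} {g : Fin k → ι}
  {W : Matrix (Fin k ⊕ Fin d) ι ℝ}

/-- Column `g i` lives in rows up to `i`, where the denominators are at least 1 + L Q(g i) because
the powers decrease; every other column meets denominators of at least 1 + c. Replacing the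
denominators by these lower bounds makes each of the `k + d` directions account for exactly 1. -/
theorem sum_div_extremalEigenvalues_le (hL : 0 < L) (hQ : ∀ v, 0 ≤ Q v) (hg : Function.Injective g)
    (hanti : Antitone fun i => Q (g i)) (hc : 0 ≤ c) (hcg : ∀ i, c ≤ L * Q (g i))
    (hdc : d * c = L * ∑ v with v ∉ Set.range g, Q v)
    (htri : ∀ i j, i < j → W (Sum.inl j) (g i) = 0) (htri' : ∀ i a, W (Sum.inr a) (g i) = 0)
    (hW : ∀ v, 0 < Q v → ∑ j, W j v ^ 2 = L) :
    ∑ j, (1 + ∑ v, Q v * (W j v * W j v)) / extremalEigenvalues L c Q g j ≤ k + d := by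
  set ν := extremalEigenvalues (d := d) L c Q g with hν
  have hνpos : ∀ j, 0 < ν j := extremalEigenvalues_pos hL hQ hc
  have hνc : ∀ j, 1 + c ≤ ν j := by
    rintro (i | a)
    · have := hcg i
      simp only [hν, extremalEigenvalues, Sum.elim_inl]
      linarith
    · exact le_rfl
  have key : ∀ v (x : ℝ), 0 < x → (∀ j, W j v = 0 ∨ x ≤ ν j) →
      Q v * ∑ j, W j v ^ 2 / ν j ≤ L * Q v / x := by
    intro v x hx h
    rcases (hQ v).eq_or_lt with h0 | h0
    · simp [← h0]
    have : ∑ j, W j v ^ 2 / ν j ≤ L / x := by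
      rw [← hW v h0, Finset.sum_div]
      refine Finset.sum_le_sum fun j _ => ?_
      rcases h j with h | h
      · simp [h]
      · gcongr
    calc _ ≤ Q v * (L / x) := by gcongr
      _ = _ := by ring
  have hsplit : ∑ j, (1 + ∑ v, Q v * (W j v * W j v)) / ν j =
      ∑ j, 1 / ν j + ∑ v, Q v * ∑ j, W j v ^ 2 / ν j := by
    simp only [add_div, Finset.sum_add_distrib, Finset.mul_sum, Finset.sum_div]
    congr 1
    rw [Finset.sum_comm]
    refine Finset.sum_congr rfl fun v _ => Finset.sum_congr rfl fun j _ => ?_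
    ring
  have hins : ∑ v with v ∈ Set.range g, Q v * ∑ j, W j v ^ 2 / ν j ≤
      ∑ i, L * Q (g i) / ν (Sum.inl i) := by
    have himg : (Finset.univ.filter fun v => v ∈ Set.range g) = Finset.univ.map ⟨g, hg⟩ := by
      ext v
      simp
    rw [himg, Finset.sum_map]
    refine Finset.sum_le_sum fun i _ => key _ _ (hνpos _) ?_
    rintro (j | a)
    · rcases lt_or_ge i j with h | h
      · exact Or.inl (htri i j h)
      · refine Or.inr ?_
        simp only [hν, extremalEigenvalues, Sum.elim_inl]
        have := hanti h
        gcongr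
    · exact Or.inl (htri' i a)
  have hout : ∑ v with v ∉ Set.range g, Q v * ∑ j, W j v ^ 2 / ν j ≤ d * c / (1 + c) := by
    rw [hdc, Finset.mul_sum, Finset.sum_div]
    exact Finset.sum_le_sum fun v _ => key v _ (by linarith) fun j => Or.inr (hνc j)
  rw [hsplit, ← Finset.sum_filter_add_sum_filter_not _ (fun v => v ∈ Set.range g),
    Fintype.sum_sum_type]
  have h1 : ∑ i : Fin k, 1 / ν (Sum.inl i) + ∑ i, L * Q (g i) / ν (Sum.inl i) = k := by
    rw [← Finset.sum_add_distrib]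
    have : ∀ i, 1 / ν (Sum.inl i) + L * Q (g i) / ν (Sum.inl i) = 1 := by
      intro i
      rw [← add_div]
      exact div_self (hνpos (Sum.inl i)).ne'
    simp only [this, Finset.sum_const, Finset.card_univ, Fintype.card_fin, nsmul_eq_mul, mul_one]
  have h2 : ∑ a : Fin d, 1 / ν (Sum.inr a) + d * c / (1 + c) = d := by
    simp only [hν, extremalEigenvalues, Sum.elim_inr, Finset.sum_const, Finset.card_univ,
      Fintype.card_fin, nsmul_eq_mul]
    have : (1 + c) ≠ 0 := by linarith
    field_simp
  linarith

/-- The determinant bound for a matrix `W` whose columns `g i` are upper triangular, with the case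
of equality. -/
theorem det_one_add_le_prod_extremalEigenvalues (hL : 0 < L) (hQ : ∀ v, 0 ≤ Q v)
    (hg : Function.Injective g)
    (hanti : Antitone fun i => Q (g i)) (hc : 0 ≤ c) (hcg : ∀ i, c ≤ L * Q (g i))
    (hdc : d * c = L * ∑ v with v ∉ Set.range g, Q v)
    (htri : ∀ i j, i < j → W (Sum.inl j) (g i) = 0) (htri' : ∀ i a, W (Sum.inr a) (g i) = 0)
    (hW : ∀ v, 0 < Q v → ∑ j, W j v ^ 2 = L) :
    (1 + W * Matrix.diagonal Q * W.transpose).det ≤ ∏ j, extremalEigenvalues (d := d) L c Q g j ∧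
      ((1 + W * Matrix.diagonal Q * W.transpose).det = ∏ j, extremalEigenvalues (d := d) L c Q g j →
        1 + W * Matrix.diagonal Q * W.transpose =
          Matrix.diagonal (extremalEigenvalues L c Q g)) := by
  have htrace := sum_div_extremalEigenvalues_le hL hQ hg hanti hc hcg hdc htri htri' hW
  have hνpos : ∀ j, 0 < extremalEigenvalues (d := d) L c Q g j := extremalEigenvalues_pos hL hQ hc
  have hM := W.posDef_one_add_mul_diagonal_mul_transpose hQ
  have hMd : ∀ j, (1 + W * Matrix.diagonal Q * W.transpose : Matrix _ _ ℝ) j j =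
      1 + ∑ v, Q v * (W j v * W j v) := by
    intro j
    rw [Matrix.add_apply, Matrix.one_apply_eq, Matrix.mul_diagonal_mul_transpose_apply]
  generalize extremalEigenvalues (d := d) L c Q g = ν at *
  generalize 1 + W * Matrix.diagonal Q * W.transpose = M at *
  -- Conjugation by ν^(-1/2) turns the comparison of M with diag ν into one of `D * M * D` with the
  -- identity, and the trace of `D * M * D` is the sum bounded in `htrace`.
  set D : Matrix (Fin k ⊕ Fin d) (Fin k ⊕ Fin d) ℝ :=
    Matrix.diagonal fun j => (√(ν j))⁻¹ with hD
  have hsq : ∀ j, √(ν j) ≠ 0 := fun j => (Real.sqrt_pos.2 (hνpos j)).ne'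
  have hDdet : D.det * D.det * ∏ j, ν j = 1 := by
    rw [hD, Matrix.det_diagonal, ← Finset.prod_mul_distrib, ← Finset.prod_mul_distrib]
    refine Finset.prod_eq_one fun j _ => ?_
    rw [← mul_inv, Real.mul_self_sqrt (hνpos j).le, inv_mul_cancel₀ (hνpos j).ne']
  have hprod : 0 < ∏ j, ν j := Finset.prod_pos fun j _ => hνpos j
  have hDu : IsUnit D := by
    rw [Matrix.isUnit_iff_isUnit_det, isUnit_iff_ne_zero]
    intro h
    simp [h] at hDdet
  have hB : (D * M * D).PosDef := by
    have := hM.mul_mul_conjTranspose_same (B := D) (Matrix.vecMul_injective_of_isUnit hDu)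
    simpa [hD, Matrix.diagonal_conjTranspose] using this
  have hBtr : (D * M * D).trace ≤ Fintype.card (Fin k ⊕ Fin d) := by
    have : (D * M * D).trace = ∑ j, M j j / ν j := by
      refine Finset.sum_congr rfl fun j _ => ?_
      rw [Matrix.diag_apply, hD, Matrix.mul_diagonal, Matrix.diagonal_mul]
      rw [mul_right_comm, ← mul_inv, Real.mul_self_sqrt (hνpos j).le]
      ring
    rw [this]
    simp only [hMd]
    simpa only [Fintype.card_sum, Fintype.card_fin, Nat.cast_add] using htrace
  have hBdet : (D * M * D).det * ∏ j, ν j = M.det := by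
    rw [Matrix.det_mul, Matrix.det_mul]
    linear_combination M.det * hDdet
  obtain ⟨h1, h2⟩ := hB.det_le_one_of_trace_le hBtr
  refine ⟨?_, fun h => ?_⟩
  · rw [← hBdet]
    nlinarith
  · have hB1 := h2 (by rw [h] at hBdet; exact mul_right_cancel₀ hprod.ne' (by rw [hBdet, one_mul]))
    ext i j
    have hij := congrFun (congrFun hB1 i) j
    rw [hD, Matrix.mul_diagonal, Matrix.diagonal_mul] at hij
    by_cases h : i = j
    · subst h
      rw [Matrix.one_apply_eq, mul_right_comm, ← mul_inv, Real.mul_self_sqrt (hνpos i).le] at hij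
      rw [Matrix.diagonal_apply_eq]
      have := (hνpos i).ne'
      field_simp at hij
      exact hij
    · rw [Matrix.one_apply_ne h] at hij
      rw [Matrix.diagonal_apply_ne _ h]
      have := hsq i
      have := hsq j
      simpa [this, hsq i] using hij

/-- If `1 + W Q Wᵀ` has the extremal diagonal form, then the users `g i` have coordinate directions
that no other active user uses. -/
theorem entry_eq_zero_of_eq_extremalEigenvalues (hQ : ∀ v, 0 ≤ Q v) (hg : Function.Injective g)
    (hgpos : ∀ i, 0 < Q (g i))
    (htri : ∀ i j, i < j → W (Sum.inl j) (g i) = 0) (htri' : ∀ i a, W (Sum.inr a) (g i) = 0)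
    (hW : ∀ v, 0 < Q v → ∑ j, W j v ^ 2 = L)
    (hM : 1 + W * Matrix.diagonal Q * W.transpose = Matrix.diagonal (extremalEigenvalues L c Q g))
    (i : Fin k) : W (Sum.inl i) (g i) ^ 2 = L ∧
      ∀ v, 0 < Q v → v ≠ g i → W (Sum.inl i) v = 0 := by
  -- In column `g i`, triangularity clears the rows after `i` and the induction hypothesis those
  -- before, so all its energy L lies in row `i`. This exhausts the diagonal entry 1 + L Q(g i), and
  -- the other nonnegative terms of that entry must vanish.
  induction i using WellFoundedLT.induction with
  | ind i ih =>
    have hsq : W (Sum.inl i) (g i) ^ 2 = L := by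
      rw [← hW _ (hgpos i)]
      symm
      apply Fintype.sum_eq_single (Sum.inl i)
      rintro (j | a) hj
      · have hji : j ≠ i := fun h => hj (congrArg _ h)
        rcases lt_or_gt_of_ne hji with h | h
        · rw [(ih j h).2 (g i) (hgpos i) (hg.ne hji.symm), zero_pow two_ne_zero]
        · rw [htri i j h, zero_pow two_ne_zero]
      · rw [htri' i a, zero_pow two_ne_zero]
    refine ⟨hsq, fun v hv hvi => ?_⟩
    have hii := congrFun (congrFun hM (Sum.inl i)) (Sum.inl i)
    rw [Matrix.add_apply, Matrix.one_apply_eq, Matrix.mul_diagonal_mul_transpose_apply,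
      Matrix.diagonal_apply_eq, ← Finset.add_sum_erase _ _ (Finset.mem_univ (g i))] at hii
    simp only [extremalEigenvalues, Sum.elim_inl] at hii
    have hzero : ∑ w ∈ Finset.univ.erase (g i), Q w * (W (Sum.inl i) w * W (Sum.inl i) w) = 0 := by
      linear_combination hii - Q (g i) * hsq
    have hnonneg : ∀ w ∈ Finset.univ.erase (g i),
        0 ≤ Q w * (W (Sum.inl i) w * W (Sum.inl i) w) :=
      fun w _ => mul_nonneg (hQ w) (mul_self_nonneg _)
    rw [Finset.sum_eq_zero_iff_of_nonneg hnonneg] at hzero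
    simpa [hv.ne'] using hzero v (Finset.mem_erase.2 ⟨hvi, Finset.mem_univ v⟩)

end TriangularBound

/-! ### Adapted orthonormal coordinates and power splits -/

/-- Gram–Schmidt orthonormalization of `k` vectors in dimension `k + d`, completed to an orthonormal
basis: the coordinates of the vectors are upper triangular. -/
theorem exists_orthogonal_triangular {N k d : ℕ} (h : k + d = N) (s : Fin k → Fin N → ℝ) :
    ∃ U : Matrix (Fin k ⊕ Fin d) (Fin N) ℝ, U * U.transpose = 1 ∧
      (∀ i j, i < j → U (Sum.inl j) ⬝ᵥ s i = 0) ∧ ∀ i a, U (Sum.inr a) ⬝ᵥ s i = 0 := by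
  subst h
  -- Padding with zero vectors gives the family as many members as the dimension; the Gram–Schmidt
  -- basis fills the degenerate places and stays triangular even if the `s i` are dependent.
  let f : Fin (k + d) → EuclideanSpace ℝ (Fin (k + d)) :=
    Fin.addCases (fun i => WithLp.toLp 2 (s i)) (fun _ => 0)
  have hrank : Module.finrank ℝ (EuclideanSpace ℝ (Fin (k + d))) = Fintype.card (Fin (k + d)) := by
    simp
  let b := InnerProductSpace.gramSchmidtOrthonormalBasis hrank f
  have hb : ∀ {i j}, i < j → inner ℝ (b j) (f i) = 0 := fun hij =>
    InnerProductSpace.gramSchmidtOrthonormalBasis_inv_triangular hrank f hij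
  have hinner : ∀ j i, inner ℝ (b j) (f (Fin.castAdd d i)) = (b j).ofLp ⬝ᵥ s i := by
    intro j i
    simp only [f, Fin.addCases_left, EuclideanSpace.inner_eq_star_dotProduct, star_trivial]
    exact dotProduct_comm _ _
  refine ⟨Matrix.of fun j x => b (finSumFinEquiv j) x, ?_, fun i j hij => ?_, fun i a => ?_⟩
  · ext i j
    have := (orthonormal_iff_ite.1 b.orthonormal) (finSumFinEquiv i) (finSumFinEquiv j)
    rw [EuclideanSpace.inner_eq_star_dotProduct, star_trivial, dotProduct_comm] at this
    rw [Matrix.mul_apply, Matrix.one_apply]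
    simpa [dotProduct] using this
  · exact (hinner _ i).symm.trans (hb (by
      rw [finSumFinEquiv_apply_left]
      exact hij))
  · exact (hinner _ i).symm.trans (hb (by
      rw [finSumFinEquiv_apply_right, Fin.lt_def]
      simp only [Fin.val_castAdd, Fin.val_natAdd]
      omega))

theorem Matrix.sum_orthogonal_mul {κ κ' ι : Type*} [Fintype κ] [Fintype κ']
    [DecidableEq κ'] {U : Matrix κ κ' ℝ} (hU : U.transpose * U = 1) (S : Matrix κ' ι ℝ) (v w : ι) :
    ∑ j, (U * S) j v * (U * S) j w = S.col v ⬝ᵥ S.col w := by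
  have h : (U * S).transpose * (U * S) = S.transpose * S := by
    rw [Matrix.transpose_mul, Matrix.mul_assoc, ← Matrix.mul_assoc U.transpose, hU, Matrix.one_mul]
  exact congrFun (congrFun h v) w

/-- `g` numbers the users in `A` in a non-increasing order of power, each user in `A` has at least
the average power per dimension that the other users have in `N - |A|` dimensions, and each other
user has at most this average. -/
structure IsPowerSplit {ι : Type*} [Fintype ι] [DecidableEq ι] (N : ℕ) (P : ι → ℝ) (A : Finset ι)
    (g : Fin A.card → ι) : Prop where
  nonneg : ∀ v, 0 ≤ P v
  pos : ∀ i, 0 < P (g i)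
  injective : Function.Injective g
  mem_iff : ∀ v, v ∈ A ↔ v ∈ Set.range g
  antitone : Antitone fun i => P (g i)
  card_le : A.card ≤ N
  rest_le : ∀ i, ∑ v with v ∉ A, P v ≤ (N - A.card : ℕ) * P (g i)
  le_rest : ∀ v, v ∉ A → (N - A.card : ℕ) * P v ≤ ∑ v with v ∉ A, P v

/-- The value of `det (I + σ⁻² S P Sᵀ)` for the optimal signature sequences. -/
noncomputable def extremalDet {ι : Type*} [Fintype ι] [DecidableEq ι] (N : ℕ) (σ : ℝ) (P : ι → ℝ)
    (A : Finset ι) (g : Fin A.card → ι) : ℝ :=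
  ∏ j, extremalEigenvalues (d := N - A.card) N
    (N * (∑ v with v ∉ A, 1 / σ ^ 2 * P v) / (N - A.card : ℕ)) (fun v => 1 / σ ^ 2 * P v) g j

theorem Matrix.smul_mul_diagonal_mul_transpose {κ ι : Type*} [Fintype ι] [DecidableEq ι] (a : ℝ)
    (S : Matrix κ ι ℝ) (P : ι → ℝ) :
    a • (S * Matrix.diagonal P * S.transpose) =
      S * Matrix.diagonal (fun v => a * P v) * S.transpose := by
  ext i j
  rw [Matrix.smul_apply, Matrix.mul_diagonal_mul_transpose_apply,
    Matrix.mul_diagonal_mul_transpose_apply, smul_eq_mul, Finset.mul_sum]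
  exact Finset.sum_congr rfl fun v _ => by ring

/-- In the coordinates `U`, each column `g i` is a nonzero multiple of its own axis, so
orthogonality to all of them says that the `inl` coordinates vanish. Both the necessity and the
existence argument use this. -/
theorem isComplementBasis_of_orthogonal {ι : Type*} {N k d : ℕ} (hN : 0 < N) {A : Finset ι}
    {g : Fin k → ι} (hA : ∀ v, v ∈ A ↔ v ∈ Set.range g) {S : Matrix (Fin N) ι ℝ}
    {U : Matrix (Fin k ⊕ Fin d) (Fin N) ℝ} (hU : U * U.transpose = 1)
    (hU' : U.transpose * U = 1) (hne : ∀ i, (U * S) (Sum.inl i) (g i) ≠ 0)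
    (hz : ∀ i j, j ≠ Sum.inl i → (U * S) j (g i) = 0) :
    IsComplementBasis A S (Matrix.of fun x a => √(N : ℝ) * U (Sum.inr a) x) := by
  have hN' : (0 : ℝ) < N := by exact_mod_cast hN
  have hs : √(N : ℝ) * √(N : ℝ) = N := Real.mul_self_sqrt hN'.le
  have hs0 : √(N : ℝ) ≠ 0 := (Real.sqrt_pos.2 hN').ne'
  set E : Matrix (Fin N) (Fin d) ℝ := Matrix.of fun x a => √(N : ℝ) * U (Sum.inr a) x with hE
  have hinner : ∀ (x : Fin N → ℝ) i, S.col (g i) ⬝ᵥ x =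
      (U * S) (Sum.inl i) (g i) * (U.mulVec x) (Sum.inl i) := by
    intro x i
    -- An auxiliary two-column matrix, with columns `S.col (g i)` (`false`) and `x` (`true`), puts
    -- this inner product into the form of the lemma.
    have h := Matrix.sum_orthogonal_mul hU' (Matrix.of fun y (b : Bool) => cond b (x y) (S y (g i)))
      false true
    refine Eq.trans h.symm ?_
    rw [Finset.sum_eq_single (Sum.inl i)]
    · rfl
    · intro j _ hj
      exact mul_eq_zero_of_left (hz i j hj) _
    · simp
  refine ⟨?_, fun x => ?_⟩
  · ext a b
    have := congrFun (congrFun hU (Sum.inr a)) (Sum.inr b)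
    rw [Matrix.mul_apply] at this
    simp only [Matrix.transpose_apply, Matrix.one_apply, Sum.inr.injEq] at this
    rw [Matrix.mul_apply, Matrix.smul_apply, Matrix.one_apply, smul_eq_mul, ← this, Finset.mul_sum]
    refine Finset.sum_congr rfl fun y _ => ?_
    simp only [hE, Matrix.transpose_apply, Matrix.of_apply]
    linear_combination U (Sum.inr a) y * U (Sum.inr b) y * hs
  · rw [← Matrix.range_mulVecLin, LinearMap.mem_range]
    constructor
    · rintro ⟨y, rfl⟩ v hv
      obtain ⟨i, rfl⟩ := (hA v).1 hv
      rw [hinner, Matrix.mulVecLin_apply, Matrix.mulVec_mulVec]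
      have : ∀ a, (U * E) (Sum.inl i) a = 0 := by
        intro a
        have := congrFun (congrFun hU (Sum.inl i)) (Sum.inr a)
        rw [Matrix.mul_apply, Matrix.one_apply_ne (by simp)] at this
        rw [Matrix.mul_apply, ← mul_zero (√(N : ℝ)), ← this, Finset.mul_sum]
        refine Finset.sum_congr rfl fun y _ => ?_
        simp only [hE, Matrix.transpose_apply, Matrix.of_apply]
        ring
      simp [Matrix.mulVec, dotProduct, this]
    · intro h
      have hx : ∀ i, (U.mulVec x) (Sum.inl i) = 0 := by
        intro i
        have := h (g i) ((hA _).2 ⟨i, rfl⟩)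
        rw [hinner] at this
        exact (mul_eq_zero.1 this).resolve_left (hne i)
      refine ⟨fun a => (√(N : ℝ))⁻¹ * (U.mulVec x) (Sum.inr a), ?_⟩
      have hx' : x = U.transpose.mulVec (U.mulVec x) := by
        rw [Matrix.mulVec_mulVec, hU', Matrix.one_mulVec]
      rw [Matrix.mulVecLin_apply]
      conv_rhs => rw [hx']
      ext y
      rw [Matrix.mulVec, Matrix.mulVec, dotProduct, dotProduct, Fintype.sum_sum_type]
      simp only [hx, mul_zero, Finset.sum_const_zero, zero_add]
      refine Finset.sum_congr rfl fun a _ => ?_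
      simp only [hE, Matrix.of_apply, Matrix.transpose_apply]
      field_simp

/-- GWBE sums run over active users, whereas the power split counts all users outside `A`; this
passes between the two. -/
theorem Finset.sum_active_eq {ι : Type*} [Fintype ι] [DecidableEq ι] {P : ι → ℝ}
    (hP : ∀ v, 0 ≤ P v) (A : Finset ι) (f : ι → ℝ) (hf : ∀ v, v ∉ A → P v = 0 → f v = 0) :
    ∑ v with v ∉ A ∧ 0 < P v, f v = ∑ v with v ∉ A, f v := by
  refine Finset.sum_subset (fun v => by simp +contextual) fun v hv hv' => ?_
  simp only [Finset.mem_filter, Finset.mem_univ, true_and, not_and, not_lt] at hv hv'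
  exact hf v hv (le_antisymm (hv' hv) (hP v))

/-! ### The inner optimization: upper bound and equality -/

section Equality

variable {K N : ℕ} {nbar : Fin K → ℕ} {σ : ℝ} {P : VirtualUser nbar → ℝ}
  {A : Finset (VirtualUser nbar)} {g : Fin A.card → VirtualUser nbar}
  {S : Matrix (Fin N) (VirtualUser nbar) ℝ}

/-- If |A| = N, the average is a division by zero with value 0. The identity survives because
`rest_le`, applied to the first user of `A` (there is one, as N > 0), forces the remaining power to
be 0. -/
theorem IsPowerSplit.mul_average {ι : Type*} [Fintype ι] [DecidableEq ι] {N : ℕ} {P : ι → ℝ}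
    {A : Finset ι} {g : Fin A.card → ι} (h : IsPowerSplit N P A g) (hN : 0 < N) (L a : ℝ) :
    (N - A.card : ℕ) * (L * (∑ v with v ∉ A, a * P v) / (N - A.card : ℕ)) =
      L * ∑ v with v ∉ A, a * P v := by
  rcases Nat.eq_zero_or_pos (N - A.card) with h0 | h0
  · have hk : A.card = N := by
      have := h.card_le
      omega
    have hle := h.rest_le ⟨0, by omega⟩
    have hge : 0 ≤ ∑ v with v ∉ A, P v := Finset.sum_nonneg fun v _ => h.nonneg v
    rw [h0] at hle ⊢
    rw [← Finset.mul_sum]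
    have : ∑ v with v ∉ A, P v = 0 := le_antisymm (by simpa using hle) hge
    simp [this]
  · have : ((N - A.card : ℕ) : ℝ) ≠ 0 := by exact_mod_cast h0.ne'
    field_simp

/-- The determinant bound of the inner optimization, with the necessary form of the sequences that
attain it. -/
theorem IsPowerSplit.det_le (h : IsPowerSplit N P A g) (hN : 0 < N) (hσ : 0 < σ)
    (hS : IsAdmissible N P S) :
    (1 + (1 / σ ^ 2) • (S * Matrix.diagonal P * S.transpose)).det ≤ extremalDet N σ P A g ∧
      ((1 + (1 / σ ^ 2) • (S * Matrix.diagonal P * S.transpose)).det = extremalDet N σ P A g →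
        IsOrthogonalGWBE N P A S) := by
  have hN' : (0 : ℝ) < N := by exact_mod_cast hN
  have hcard := Nat.add_sub_of_le h.card_le
  obtain ⟨U, hU, htri, htri'⟩ := exists_orthogonal_triangular hcard fun i => S.col (g i)
  have hU' : U.transpose * U = 1 := by
    rwa [Matrix.mul_eq_one_comm_of_card_eq]
    simp only [Fintype.card_sum, Fintype.card_fin]
    omega
  replace htri : ∀ i j, i < j → (U * S) (Sum.inl j) (g i) = 0 := htri
  replace htri' : ∀ i a, (U * S) (Sum.inr a) (g i) = 0 := htri'
  have hσ2 : 0 < 1 / σ ^ 2 := by positivity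
  rw [Matrix.smul_mul_diagonal_mul_transpose, extremalDet,
    ← Matrix.det_one_add_orthogonal_mul U hU']
  have hL := h.mul_average hN N (1 / σ ^ 2)
  have hcg : ∀ i, (N * (∑ v with v ∉ A, 1 / σ ^ 2 * P v) / (N - A.card : ℕ) : ℝ) ≤
      N * (1 / σ ^ 2 * P (g i)) := by
    intro i
    rcases Nat.eq_zero_or_pos (N - A.card) with h0 | h0
    · rw [h0]
      have := h.pos i
      simp only [Nat.cast_zero, div_zero]
      positivity
    · have : (0 : ℝ) < (N - A.card : ℕ) := by exact_mod_cast h0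
      rw [div_le_iff₀ this, ← Finset.mul_sum]
      calc _ ≤ (N : ℝ) * (1 / σ ^ 2 * ((N - A.card : ℕ) * P (g i))) := by
            gcongr
            exact h.rest_le i
        _ = _ := by ring
  have hW : ∀ v, 0 < P v → ∑ j, (U * S) j v ^ 2 = N := by
    intro v hv
    rw [← hS v hv, ← Matrix.sum_orthogonal_mul hU' S v v]
    exact Finset.sum_congr rfl fun j _ => sq _
  have hQpos : ∀ v, 0 < 1 / σ ^ 2 * P v → 0 < P v := fun v hv => pos_of_mul_pos_right hv hσ2.le
  have hrange : ∑ v with v ∉ A, 1 / σ ^ 2 * P v = ∑ v with v ∉ Set.range g, 1 / σ ^ 2 * P v :=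
    Finset.sum_congr (by ext v; simp [h.mem_iff]) fun _ _ => rfl
  have hQ : ∀ v, 0 ≤ 1 / σ ^ 2 * P v := fun v => mul_nonneg hσ2.le (h.nonneg v)
  have hc : (0 : ℝ) ≤ N * (∑ v with v ∉ A, 1 / σ ^ 2 * P v) / (N - A.card : ℕ) :=
    div_nonneg (mul_nonneg hN'.le (Finset.sum_nonneg fun v _ => hQ v)) (Nat.cast_nonneg _)
  obtain ⟨hle, heq⟩ := det_one_add_le_prod_extremalEigenvalues (W := U * S) hN' hQ h.injective
    (fun i j hij => mul_le_mul_of_nonneg_left (h.antitone hij) hσ2.le) hc hcg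
    (by rw [← hrange]; exact hL) htri htri' (fun v hv => hW v (hQpos v hv))
  refine ⟨hle, fun hdet => ?_⟩
  have hM := heq hdet
  have hentry := entry_eq_zero_of_eq_extremalEigenvalues (W := U * S) hQ h.injective
    (fun i => mul_pos hσ2 (h.pos i)) htri htri' (fun v hv => hW v (hQpos v hv)) hM
  -- Row `j` of the first block belongs to `g j` alone, so the triangular columns are in fact
  -- diagonal.
  have hz : ∀ i j, j ≠ Sum.inl i → (U * S) j (g i) = 0 := by
    rintro i (j | a) hj
    · have hij : i ≠ j := fun hij => hj (congrArg _ hij.symm)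
      exact (hentry j).2 _ (mul_pos hσ2 (h.pos i)) (h.injective.ne hij)
    · exact htri' i a
  have hne : ∀ i, (U * S) (Sum.inl i) (g i) ≠ 0 := by
    intro i h0
    have := (hentry i).1
    rw [h0, zero_pow two_ne_zero] at this
    exact hN'.ne this
  have hs0 : √(N : ℝ) ≠ 0 := (Real.sqrt_pos.2 hN').ne'
  have hnot : ∀ v, v ∉ A → ∀ i, v ≠ g i := fun v hv i hi => hv ((h.mem_iff v).2 ⟨i, hi.symm⟩)
  refine ⟨fun v hv => ?_, fun v hv w hw hvw => ?_, Matrix.of fun x a => √(N : ℝ) * U (Sum.inr a) x,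
    fun v a => (√(N : ℝ))⁻¹ * (U * S) (Sum.inr a) v,
    isComplementBasis_of_orthogonal hN h.mem_iff hU hU' hne hz, fun v hv hPv => ?_,
    fun v hv => ?_, ?_⟩
  · obtain ⟨i, rfl⟩ := (h.mem_iff v).1 hv
    exact hS _ (h.pos i)
  · obtain ⟨i, rfl⟩ := (h.mem_iff v).1 hv
    obtain ⟨j, rfl⟩ := (h.mem_iff w).1 hw
    rw [← Matrix.sum_orthogonal_mul hU']
    refine Finset.sum_eq_zero fun l _ => ?_
    by_cases hl : l = Sum.inl i
    · refine mul_eq_zero_of_right _ (hz j l ?_)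
      rintro rfl
      rw [Sum.inl.injEq] at hl
      exact hvw (congrArg g hl.symm)
    · exact mul_eq_zero_of_left (hz i l hl) _
  -- The active users outside `A` have no component along the first axes, so expanding in the basis
  -- `U` leaves only the columns of `E`.
  · have hSU : S = U.transpose * (U * S) := by rw [← Matrix.mul_assoc, hU', Matrix.one_mul]
    ext x
    conv_lhs => rw [Matrix.col_apply, hSU]
    rw [Matrix.mul_apply, Fintype.sum_sum_type, Finset.sum_eq_zero, zero_add]
    · refine Finset.sum_congr rfl fun a _ => ?_
      simp only [Matrix.of_apply, Matrix.transpose_apply]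
      field_simp
    · intro i _
      rw [(hentry i).2 v (mul_pos hσ2 hPv) (hnot v hv i), mul_zero]
  · simp only [Finset.mem_filter, Finset.mem_univ, true_and] at hv
    have := hW v hv.2
    rw [Fintype.sum_sum_type, Finset.sum_eq_zero, zero_add] at this
    · rw [dotProduct, ← mul_inv_cancel₀ hN'.ne', ← this, Finset.sum_mul]
      refine Finset.sum_congr rfl fun a _ => ?_
      rw [this]
      nth_rw 3 [← Real.mul_self_sqrt hN'.le]
      rw [mul_inv]
      ring
    · intro i _
      rw [(hentry i).2 v (mul_pos hσ2 hv.2) (hnot v hv.1 i), zero_pow two_ne_zero]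
  -- The lower right block of `hM`, divided by N/σ², is the GWBE identity, since the users in `A`
  -- contribute nothing to that block.
  · ext a b
    have hab := congrFun (congrFun hM (Sum.inr a)) (Sum.inr b)
    rw [Matrix.add_apply, Matrix.mul_diagonal_mul_transpose_apply] at hab
    have hleft : ∑ v, 1 / σ ^ 2 * P v * ((U * S) (Sum.inr a) v * (U * S) (Sum.inr b) v) =
        N * (1 / σ ^ 2) * ∑ v with v ∉ A ∧ 0 < P v,
          P v * ((√(N : ℝ))⁻¹ * (U * S) (Sum.inr a) v * ((√(N : ℝ))⁻¹ * (U * S) (Sum.inr b) v)) := by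
      rw [Finset.sum_active_eq h.nonneg A _ (fun v _ hv => by rw [hv, zero_mul]), Finset.mul_sum,
        ← Finset.sum_filter_add_sum_filter_not Finset.univ (fun v => v ∈ A), Finset.sum_eq_zero,
        zero_add]
      · refine Finset.sum_congr rfl fun v _ => ?_
        nth_rw 1 [← Real.mul_self_sqrt hN'.le]
        field_simp
      · intro v hv
        obtain ⟨i, rfl⟩ := (h.mem_iff v).1 (Finset.mem_filter.1 hv).2
        rw [htri', zero_mul, mul_zero]
    have hfac : ∑ v with v ∉ A, 1 / σ ^ 2 * P v = 1 / σ ^ 2 * ∑ v with v ∉ A ∧ 0 < P v, P v := by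
      rw [Finset.sum_active_eq h.nonneg A _ fun _ _ hv => hv, Finset.mul_sum]
    rw [hleft, Matrix.diagonal_apply, Matrix.one_apply] at hab
    simp only [extremalEigenvalues, Sum.elim_inr, hfac, Sum.inr.injEq] at hab
    have hN0 : (N : ℝ) * (1 / σ ^ 2) ≠ 0 := (mul_pos hN' hσ2).ne'
    rw [Matrix.sum_apply, Matrix.smul_apply, Matrix.one_apply, smul_eq_mul]
    simp only [Matrix.smul_apply, Matrix.vecMulVec_apply, smul_eq_mul]
    convert_to ∑ v with v ∉ A ∧ 0 < P v, P v * ((√(N : ℝ))⁻¹ * (U * S) (Sum.inr a) v *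
      ((√(N : ℝ))⁻¹ * (U * S) (Sum.inr b) v)) =
        (∑ v with v ∉ A ∧ 0 < P v, P v) / ((N - A.card : ℕ) : ℝ) * if a = b then 1 else 0
    refine mul_left_cancel₀ hN0 ?_
    split_ifs at hab ⊢ <;> linear_combination hab

end Equality

/-! ### Parseval frames with prescribed norms -/

theorem Finset.sum_univ_eq_of_pair {ι M : Type*} [Fintype ι] [DecidableEq ι] [AddCommMonoid M]
    {i j : ι} (hij : i ≠ j) {f f' : ι → M} (hne : ∀ l, l ≠ i → l ≠ j → f l = f' l)
    (h : f i + f j = f' i + f' j) : ∑ l, f l = ∑ l, f' l := by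
  have key : ∀ F : ι → M, ∑ l, F l = F i + F j + ∑ l ∈ (univ.erase i).erase j, F l := by
    intro F
    rw [add_assoc, add_sum_erase _ _ (mem_erase.2 ⟨hij.symm, mem_univ j⟩),
      add_sum_erase _ _ (mem_univ i)]
  rw [key f, key f', h]
  congr 1
  refine sum_congr rfl fun l hl => ?_
  simp only [mem_erase, mem_univ, and_true] at hl
  exact hne l hl.2 hl.1

/-- A plane rotation of two vectors can give one of them any squared norm between the two original
ones. -/
theorem exists_rotation_dotProduct_eq {n : Type*} [Fintype n] (x y : n → ℝ) {t : ℝ}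
    (h1 : t ≤ x ⬝ᵥ x) (h2 : y ⬝ᵥ y ≤ t) :
    ∃ c s : ℝ, c ^ 2 + s ^ 2 = 1 ∧ (c • x + s • y) ⬝ᵥ (c • x + s • y) = t := by
  let f : ℝ → ℝ := fun θ =>
    (Real.cos θ • x + Real.sin θ • y) ⬝ᵥ (Real.cos θ • x + Real.sin θ • y)
  have hf : Continuous f := by
    simp only [f, dotProduct, Pi.add_apply, Pi.smul_apply, smul_eq_mul]
    fun_prop
  -- The rotation runs from `x` at angle 0 to `y` at angle π/2, so the intermediate value theorem
  -- applies.
  have h := intermediate_value_Icc' (by positivity : (0 : ℝ) ≤ Real.pi / 2) hf.continuousOn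
  obtain ⟨θ, -, hθ⟩ := h (show t ∈ Set.Icc (f (Real.pi / 2)) (f 0) by simp [f, h1, h2])
  exact ⟨Real.cos θ, Real.sin θ, Real.cos_sq_add_sin_sq θ, hθ⟩

/-- Parseval frames of `ℝᵈ` with prescribed squared norms between zero and one. -/
theorem exists_parseval_frame {ι : Type*} [Fintype ι] [DecidableEq ι] {d : ℕ} (a : ι → ℝ)
    (h0 : ∀ i, 0 ≤ a i) (h1 : ∀ i, a i ≤ 1) (hsum : ∑ i, a i = d) :
    ∃ v : ι → Fin d → ℝ, (∀ i, v i ⬝ᵥ v i = a i) ∧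
      ∑ i, Matrix.vecMulVec (v i) (v i) = 1 := by
  -- The induction is on the number of norms strictly between 0 and 1. Two of them are pushed apart
  -- until one becomes 0 or 1, and a plane rotation of the resulting frame restores the original
  -- norms.
  induction hn : (Finset.univ.filter fun i => a i ≠ 0 ∧ a i ≠ 1).card
    using Nat.strong_induction_on generalizing a with
  | _ n ih =>
  subst hn
  by_cases hfrac : ∃ i, a i ≠ 0 ∧ a i ≠ 1
  -- A single fractional norm is impossible, because the sum of all norms is the integer `d`.
  · have hpair : ∃ i j, i ≠ j ∧ (a i ≠ 0 ∧ a i ≠ 1) ∧ (a j ≠ 0 ∧ a j ≠ 1) := by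
      obtain ⟨i, hi⟩ := hfrac
      by_contra! hcon
      have hrest : ∀ l ∈ Finset.univ.erase i, a l = if a l = 1 then 1 else 0 := by
        intro l hl
        split_ifs with h
        · exact h
        · by_contra hl0
          exact h (hcon i l (Finset.ne_of_mem_erase hl).symm hi hl0)
      rw [← Finset.add_sum_erase _ _ (Finset.mem_univ i), Finset.sum_congr rfl hrest,
        Finset.sum_boole] at hsum
      have hlt : a i < 1 := lt_of_le_of_ne (h1 i) hi.2
      have hgt : 0 < a i := lt_of_le_of_ne (h0 i) (Ne.symm hi.1)
      generalize Finset.card _ = q at hsum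
      have hq1 : q < d := by
        have : (q : ℝ) < d := by linarith
        exact_mod_cast this
      have hq2 : d < q + 1 := by
        have : (d : ℝ) < (q : ℝ) + 1 := by linarith
        exact_mod_cast this
      omega
    have hpair' : ∃ i j, i ≠ j ∧ a j ≤ a i ∧ (a i ≠ 0 ∧ a i ≠ 1) ∧ (a j ≠ 0 ∧ a j ≠ 1) := by
      obtain ⟨i, j, hij, hi, hj⟩ := hpair
      rcases le_total (a j) (a i) with h | h
      · exact ⟨i, j, hij, h, hi, hj⟩
      · exact ⟨j, i, hij.symm, h, hj, hi⟩
    obtain ⟨i, j, hij, hle, hi, hj⟩ := hpair'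
    -- The largest transfer from `a j` to `a i` that keeps both in [0, 1]; it makes `a i` equal to 1
    -- or `a j` equal to 0.
    obtain ⟨t, ht0, hti, htj, ht⟩ : ∃ t, 0 ≤ t ∧ t ≤ 1 - a i ∧ t ≤ a j ∧
        (t = 1 - a i ∨ t = a j) :=
      ⟨min (1 - a i) (a j), le_min (sub_nonneg.2 (h1 i)) (h0 j), min_le_left _ _,
        min_le_right _ _, min_choice _ _⟩
    let a' : ι → ℝ := fun l => if l = i then a i + t else if l = j then a j - t else a l
    have hai : a' i = a i + t := by simp [a']
    have haj : a' j = a j - t := by simp [a', hij.symm]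
    have hal : ∀ l, l ≠ i → l ≠ j → a' l = a l := fun l h h' => by simp [a', h, h']
    have hcases : ∀ (p : ι → ℝ → Prop), p i (a i + t) → p j (a j - t) → (∀ l, p l (a l)) →
        ∀ l, p l (a' l) := by
      intro p hpi hpj hp l
      by_cases hli : l = i
      · rw [hli, hai]; exact hpi
      by_cases hlj : l = j
      · rw [hlj, haj]; exact hpj
      rw [hal l hli hlj]
      exact hp l
    have hlt : (Finset.univ.filter fun l => a' l ≠ 0 ∧ a' l ≠ 1).card <
        (Finset.univ.filter fun l => a l ≠ 0 ∧ a l ≠ 1).card := by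
      refine Finset.card_lt_card (Finset.ssubset_iff_subset_ne.2 ⟨?_, fun heq => ?_⟩)
      · intro l
        simp only [Finset.mem_filter, Finset.mem_univ, true_and]
        exact hcases (fun l x => x ≠ 0 ∧ x ≠ 1 → a l ≠ 0 ∧ a l ≠ 1) (fun _ => hi) (fun _ => hj)
          (fun _ h => h) l
      · rcases ht with ht | ht
        · have : i ∈ Finset.univ.filter fun l => a l ≠ 0 ∧ a l ≠ 1 := by simp [hi]
          rw [← heq] at this
          simp [hai, ht] at this
        · have : j ∈ Finset.univ.filter fun l => a l ≠ 0 ∧ a l ≠ 1 := by simp [hj]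
          rw [← heq] at this
          simp [haj, ht] at this
    obtain ⟨w, hw, hwsum⟩ := ih _ hlt a'
      (hcases (fun _ x => 0 ≤ x) (add_nonneg (h0 i) ht0) (sub_nonneg.2 htj) h0)
      (hcases (fun _ x => x ≤ 1) (by linarith) (by linarith [h1 j]) h1)
      (by
        rw [← hsum]
        exact Finset.sum_univ_eq_of_pair hij hal (by rw [hai, haj]; ring)) rfl
    -- Since a j - t ≤ a i ≤ a i + t, the target norm lies between those of `w j` and `w i`. The
    -- rotation preserves the sum of the two rank-one matrices, hence also the sum of the norms,
    -- which fixes that of `v j`.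
    obtain ⟨c, s, hcs, hnorm⟩ := exists_rotation_dotProduct_eq (w i) (w j) (t := a i)
      (by rw [hw, hai]; linarith) (by rw [hw, haj]; linarith)
    let v : ι → Fin d → ℝ := fun l =>
      if l = i then c • w i + s • w j else if l = j then c • w j - s • w i else w l
    have hvi : v i = c • w i + s • w j := by simp [v]
    have hvj : v j = c • w j - s • w i := by simp [v, hij.symm]
    have hvl : ∀ l, l ≠ i → l ≠ j → v l = w l := fun l h h' => by simp [v, h, h']
    have hpairsum : ∀ x y : Fin d, v i x * v i y + v j x * v j y =
        w i x * w i y + w j x * w j y := by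
      intro x y
      simp only [hvi, hvj, Pi.add_apply, Pi.sub_apply, Pi.smul_apply, smul_eq_mul]
      linear_combination (w i x * w i y + w j x * w j y) * hcs
    refine ⟨v, fun l => ?_, ?_⟩
    · have hnormi : v i ⬝ᵥ v i = a i := by rw [hvi, hnorm]
      by_cases hli : l = i
      · rw [hli, hnormi]
      by_cases hlj : l = j
      · have : v i ⬝ᵥ v i + v j ⬝ᵥ v j = w i ⬝ᵥ w i + w j ⬝ᵥ w j := by
          simp only [dotProduct, ← Finset.sum_add_distrib, hpairsum]
        rw [hw, hw, hai, haj, hnormi] at this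
        rw [hlj]
        linarith
      rw [hvl l hli hlj, hw, hal l hli hlj]
    · rw [← hwsum]
      refine Finset.sum_univ_eq_of_pair hij (fun l h h' => by rw [hvl l h h']) ?_
      ext x y
      simpa [Matrix.vecMulVec_apply] using hpairsum x y
  · push Not at hfrac
    have hite : ∀ l, a l = if a l = 1 then 1 else 0 := by
      intro l
      split_ifs with h
      · exact h
      · by_contra hl
        exact h (hfrac l hl)
    have hcard : (Finset.univ.filter fun l => a l = 1).card = d := by
      rw [Finset.sum_congr rfl fun l _ => hite l, Finset.sum_boole] at hsum
      exact_mod_cast hsum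
    -- Exactly `d` norms equal 1 and the others 0: the standard basis padded with zero vectors is
    -- the frame.
    let φ := Finset.equivFinOfCardEq hcard
    refine ⟨fun l => if h : l ∈ Finset.univ.filter (fun l => a l = 1) then
      Pi.single (φ ⟨l, h⟩) 1 else 0, fun l => ?_, ?_⟩
    · rw [hite l]
      by_cases h : a l = 1 <;> simp [h]
    · rw [← Finset.sum_subset (Finset.subset_univ (Finset.univ.filter fun l => a l = 1)),
        ← Finset.sum_coe_sort]
      · rw [← φ.symm.sum_comp]
        ext x y
        rw [Matrix.sum_apply]
        simp [Matrix.vecMulVec_apply, Matrix.one_apply, Pi.single_apply, -Finset.mem_filter]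
      · intro l _ hl
        simp only [dif_neg hl, Matrix.zero_vecMulVec]

/-! ### The inner optimization: attainment -/

section Form

variable {K N : ℕ} {nbar : Fin K → ℕ} {σ : ℝ} {P : VirtualUser nbar → ℝ}
  {A : Finset (VirtualUser nbar)} {g : Fin A.card → VirtualUser nbar}
  {S : Matrix (Fin N) (VirtualUser nbar) ℝ}

/-- Sequences of the orthogonal GWBE form are admissible and attain the determinant bound. -/
theorem IsOrthogonalGWBE.isAdmissible_and_det_eq (hS : IsOrthogonalGWBE N P A S)
    (h : IsPowerSplit N P A g) (hN : 0 < N) :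
    IsAdmissible N P S ∧
      (1 + (1 / σ ^ 2) • (S * Matrix.diagonal P * S.transpose)).det = extremalDet N σ P A g := by
  have hN' : (0 : ℝ) < N := by exact_mod_cast hN
  have hs : √(N : ℝ) * √(N : ℝ) = N := Real.mul_self_sqrt hN'.le
  have hs0 : √(N : ℝ) ≠ 0 := (Real.sqrt_pos.2 hN').ne'
  obtain ⟨hnorm, horth, E, s, ⟨hE, hspan⟩, hcol, hunit, hsum⟩ := hS
  have hgA : ∀ i, g i ∈ A := fun i => (h.mem_iff _).2 ⟨i, rfl⟩
  have hgg : ∀ i j, S.col (g i) ⬝ᵥ S.col (g j) = if i = j then (N : ℝ) else 0 := by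
    intro i j
    split_ifs with hij
    · rw [← hij, hnorm _ (hgA i)]
    · exact horth _ (hgA i) _ (hgA j) (h.injective.ne hij)
  have hEE : ∀ a b, E.col a ⬝ᵥ E.col b = if a = b then (N : ℝ) else 0 := by
    intro a b
    refine (congrFun (congrFun hE a) b).trans ?_
    rw [Matrix.smul_apply, Matrix.one_apply, smul_eq_mul]
    split_ifs <;> simp
  have hgE : ∀ i a, S.col (g i) ⬝ᵥ E.col a = 0 := fun i a =>
    (hspan _).1 (Submodule.subset_span ⟨a, rfl⟩) _ (hgA i)
  have hEmul : ∀ a v, v ∉ A → 0 < P v → E.col a ⬝ᵥ S.col v = N * s v a := by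
    intro a v hv hPv
    have : (E.transpose.mulVec (E.mulVec (s v))) a = N * s v a := by
      rw [Matrix.mulVec_mulVec, hE, Matrix.smul_mulVec, Matrix.one_mulVec]
      rfl
    rw [hcol v hv hPv, ← this]
    rfl
  have hgcol : ∀ i v, v ∉ A → 0 < P v → S.col (g i) ⬝ᵥ S.col v = 0 := by
    intro i v hv hPv
    refine (hspan _).1 ?_ _ (hgA i)
    rw [hcol v hv hPv, ← Matrix.range_mulVecLin]
    exact ⟨s v, rfl⟩
  refine ⟨fun v hPv => ?_, ?_⟩
  · by_cases hv : v ∈ A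
    · exact hnorm v hv
    · have h1 : s v ⬝ᵥ s v = 1 := hunit v (by simp [hv, hPv])
      have : (E.mulVec (s v)) ⬝ᵥ (E.mulVec (s v)) = N * (s v ⬝ᵥ s v) := by
        rw [Matrix.dotProduct_mulVec, ← Matrix.mulVec_transpose, Matrix.mulVec_mulVec, hE,
          Matrix.smul_mulVec, Matrix.one_mulVec, smul_dotProduct, smul_eq_mul]
      rw [hcol v hv hPv, this, h1, mul_one]
  -- The normalized columns `g i` and columns of `E` form an orthonormal basis in which the matrix
  -- is exactly diagonal, so the determinants are compared through their entries.
  let U : Matrix (Fin A.card ⊕ Fin (N - A.card)) (Fin N) ℝ :=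
    Matrix.of (Sum.elim (fun i x => (√(N : ℝ))⁻¹ * S x (g i)) fun a x => (√(N : ℝ))⁻¹ * E x a)
  have hUl : ∀ i (y : Fin N → ℝ), ∑ x, U (Sum.inl i) x * y x =
      (√(N : ℝ))⁻¹ * (S.col (g i) ⬝ᵥ y) := by
    intro i y
    rw [dotProduct, Finset.mul_sum]
    exact Finset.sum_congr rfl fun x _ => mul_assoc _ _ _
  have hUr : ∀ a (y : Fin N → ℝ), ∑ x, U (Sum.inr a) x * y x =
      (√(N : ℝ))⁻¹ * (E.col a ⬝ᵥ y) := by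
    intro a y
    rw [dotProduct, Finset.mul_sum]
    exact Finset.sum_congr rfl fun x _ => mul_assoc _ _ _
  have hcoll : ∀ i, U (Sum.inl i) = (√(N : ℝ))⁻¹ • S.col (g i) := fun i => rfl
  have hcolr : ∀ a, U (Sum.inr a) = (√(N : ℝ))⁻¹ • E.col a := fun a => rfl
  have hone : (√(N : ℝ))⁻¹ * ((√(N : ℝ))⁻¹ * N) = 1 := by
    rw [← mul_assoc, ← mul_inv, hs, inv_mul_cancel₀ hN'.ne']
  have hU : U * U.transpose = 1 := by
    ext j j'
    rw [Matrix.mul_apply, Matrix.one_apply]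
    simp only [Matrix.transpose_apply]
    rcases j with i | a <;> rcases j' with i' | a'
    · rw [hUl, hcoll, dotProduct_smul, hgg]
      by_cases hi : i = i' <;> simp [hi, hone]
    · rw [hUl, hcolr, dotProduct_smul, hgE]
      simp
    · rw [hUr, hcoll, dotProduct_smul, dotProduct_comm, hgE]
      simp
    · rw [hUr, hcolr, dotProduct_smul, hEE]
      by_cases hi : a = a' <;> simp [hi, hone]
  have hU' : U.transpose * U = 1 := by
    rwa [Matrix.mul_eq_one_comm_of_card_eq]
    have := h.card_le
    simp only [Fintype.card_sum, Fintype.card_fin]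
    omega
  have hWl : ∀ i v, (U * S) (Sum.inl i) v = (√(N : ℝ))⁻¹ * (S.col (g i) ⬝ᵥ S.col v) :=
    fun i v => hUl i _
  have hWr : ∀ a v, (U * S) (Sum.inr a) v = (√(N : ℝ))⁻¹ * (E.col a ⬝ᵥ S.col v) :=
    fun a v => hUr a _
  have hWlg : ∀ i i', (U * S) (Sum.inl i) (g i') = if i = i' then √(N : ℝ) else 0 := by
    intro i i'
    rw [hWl, hgg]
    split_ifs
    · rw [inv_mul_eq_iff_eq_mul₀ hs0, hs]
    · rw [mul_zero]
  have hWrA : ∀ a v, v ∈ A → (U * S) (Sum.inr a) v = 0 := by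
    intro a v hv
    obtain ⟨i, rfl⟩ := (h.mem_iff v).1 hv
    rw [hWr, dotProduct_comm, hgE, mul_zero]
  have hWlv : ∀ i v, v ∉ A → 0 < P v → (U * S) (Sum.inl i) v = 0 := by
    intro i v hv hPv
    rw [hWl, hgcol i v hv hPv, mul_zero]
  have hWrv : ∀ a v, v ∉ A → 0 < P v → (U * S) (Sum.inr a) v = √(N : ℝ) * s v a := by
    intro a v hv hPv
    rw [hWr, hEmul a v hv hPv, inv_mul_eq_iff_eq_mul₀ hs0, ← mul_assoc, hs]
  rw [Matrix.smul_mul_diagonal_mul_transpose, extremalDet, ← Matrix.det_one_add_orthogonal_mul U hU',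
    ← Matrix.det_diagonal]
  congr 1
  -- The off-diagonal blocks vanish: no active user has components in both the span of the users in
  -- `A` and its complement.
  have hmixed : ∀ i a, ∑ v, 1 / σ ^ 2 * P v * ((U * S) (Sum.inl i) v * (U * S) (Sum.inr a) v) =
      0 := by
    intro i a
    refine Finset.sum_eq_zero fun v _ => ?_
    by_cases hv : v ∈ A
    · rw [hWrA a v hv, mul_zero, mul_zero]
    · rcases (h.nonneg v).eq_or_lt with h0 | h0
      · rw [← h0, mul_zero, zero_mul]
      · rw [hWlv i v hv h0, zero_mul, mul_zero]
  ext j j'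
  rw [Matrix.add_apply, Matrix.mul_diagonal_mul_transpose_apply, Matrix.one_apply,
    Matrix.diagonal_apply]
  rcases j with i | a <;> rcases j' with i' | a'
  · rw [Finset.sum_eq_single (g i)]
    · rw [hWlg, hWlg]
      by_cases hi : i = i'
      · subst hi
        simp only [if_true, extremalEigenvalues, Sum.elim_inl]
        linear_combination 1 / σ ^ 2 * P (g i) * hs
      · simp [hi, Ne.symm hi]
    · intro v _ hv
      by_cases hvA : v ∈ A
      · obtain ⟨l, rfl⟩ := (h.mem_iff v).1 hvA
        have : i ≠ l := fun hil => hv (congrArg g hil.symm)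
        rw [hWlg i l, if_neg this, zero_mul, mul_zero]
      · rcases (h.nonneg v).eq_or_lt with h0 | h0
        · rw [← h0, mul_zero, zero_mul]
        · rw [hWlv i v hvA h0, zero_mul, mul_zero]
    · simp
  · rw [hmixed]
    simp
  · simp only [mul_comm ((U * S) (Sum.inr a) _)]
    rw [hmixed]
    simp
  · rw [← Finset.sum_filter_add_sum_filter_not Finset.univ (fun v => v ∈ A), Finset.sum_eq_zero,
      zero_add, ← Finset.sum_active_eq h.nonneg A _ (fun v _ hv => by rw [hv, mul_zero, zero_mul])]
    · have hab := congrFun (congrFun hsum a) a'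
      rw [Matrix.sum_apply, Matrix.smul_apply, Matrix.one_apply, smul_eq_mul] at hab
      simp only [Matrix.smul_apply, Matrix.vecMulVec_apply, smul_eq_mul] at hab
      replace hab : ∑ v with v ∉ A ∧ 0 < P v, P v * (s v a * s v a') =
          (∑ v with v ∉ A ∧ 0 < P v, P v) / ((N - A.card : ℕ) : ℝ) *
            if a = a' then 1 else 0 := by
        convert hab
      have hterm : ∑ v with v ∉ A ∧ 0 < P v,
            1 / σ ^ 2 * P v * ((U * S) (Sum.inr a) v * (U * S) (Sum.inr a') v) =
          N * (1 / σ ^ 2) * ∑ v with v ∉ A ∧ 0 < P v, P v * (s v a * s v a') := by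
        rw [Finset.mul_sum]
        refine Finset.sum_congr rfl fun v hv => ?_
        simp only [Finset.mem_filter, Finset.mem_univ, true_and] at hv
        rw [hWrv a v hv.1 hv.2, hWrv a' v hv.1 hv.2]
        linear_combination 1 / σ ^ 2 * P v * s v a * s v a' * hs
      rw [hterm, hab, Finset.sum_active_eq h.nonneg A _ fun _ _ hv => hv]
      by_cases hi : a = a'
      · subst hi
        simp only [if_true, extremalEigenvalues, Sum.elim_inr, ← Finset.mul_sum]
        ring
      · simp [hi]
    · intro v hv
      rw [hWrA a v (Finset.mem_filter.1 hv).2, zero_mul, mul_zero]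

/-- Generalized Welch-bound-equality sequences exist if no power exceeds the average power per
dimension. -/
theorem exists_isGWBE {ι : Type*} [Fintype ι] [DecidableEq ι] {d : ℕ} {P : ι → ℝ} (B : Finset ι)
    (hP : ∀ v ∈ B, 0 < P v) (hle : ∀ v ∈ B, d * P v ≤ ∑ v ∈ B, P v) (hd : B.Nonempty → 0 < d) :
    ∃ s : ι → Fin d → ℝ, IsGWBE B P s := by
  rcases B.eq_empty_or_nonempty with rfl | hB
  · exact ⟨0, by simp [IsGWBE]⟩
  have hd' : (0 : ℝ) < d := by exact_mod_cast hd hB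
  have hR : 0 < ∑ v ∈ B, P v := Finset.sum_pos hP hB
  set R := ∑ v ∈ B, P v with hRdef
  -- Absorbing the factor d P v / R into the vectors turns the GWBE identity into the Parseval
  -- identity with these squared norms; `hle` says that they are at most 1.
  let a : ι → ℝ := fun v => if v ∈ B then d * P v / R else 0
  have haB : ∀ v ∈ B, a v = d * P v / R := fun v hv => if_pos hv
  have hpos : ∀ v ∈ B, 0 < a v := by
    intro v hv
    rw [haB v hv]
    have := hP v hv
    positivity
  have ha0 : ∀ v, v ∉ B → a v = 0 := fun v hv => if_neg hv
  obtain ⟨w, hw, hwsum⟩ := exists_parseval_frame (d := d) a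
    (fun v => by
      by_cases hv : v ∈ B
      · exact (hpos v hv).le
      · exact (ha0 v hv).ge)
    (fun v => by
      by_cases hv : v ∈ B
      · rw [haB v hv, div_le_one hR]
        exact hle v hv
      · rw [ha0 v hv]
        exact zero_le_one)
    (by
      simp only [a, ← Finset.sum_filter, Finset.filter_mem_eq_inter, Finset.univ_inter]
      rw [← Finset.sum_div, ← Finset.mul_sum, ← hRdef, mul_div_cancel_right₀ _ hR.ne'])
  refine ⟨fun v => (√(a v))⁻¹ • w v, fun v hv => ?_, ?_⟩
  · rw [smul_dotProduct, dotProduct_smul, hw, smul_eq_mul, smul_eq_mul, ← mul_assoc, ← mul_inv,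
      Real.mul_self_sqrt (hpos v hv).le, inv_mul_cancel₀ (hpos v hv).ne']
  · rw [← hwsum, ← Finset.sum_subset (Finset.subset_univ B), Finset.smul_sum]
    · refine Finset.sum_congr rfl fun v hv => ?_
      rw [Matrix.smul_vecMulVec, Matrix.vecMulVec_smul, smul_smul, smul_smul, mul_assoc, ← mul_inv,
        Real.mul_self_sqrt (hpos v hv).le, haB v hv, ← hRdef]
      congr 1
      have := (hP v hv).ne'
      field_simp
    · intro v _ hv
      have : w v = 0 := dotProduct_self_eq_zero.1 ((hw v).trans (ha0 v hv))
      rw [this, Matrix.zero_vecMulVec]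

/-- The users in `A` get √N times the first coordinate vectors, and GWBE sequences fill the
remaining coordinates. -/
theorem IsPowerSplit.exists_isOrthogonalGWBE (h : IsPowerSplit N P A g) (hN : 0 < N) :
    ∃ S : Matrix (Fin N) (VirtualUser nbar) ℝ, IsOrthogonalGWBE N P A S := by
  have hN' : (0 : ℝ) < N := by exact_mod_cast hN
  have hs : √(N : ℝ) * √(N : ℝ) = N := Real.mul_self_sqrt hN'.le
  have hs0 : √(N : ℝ) ≠ 0 := (Real.sqrt_pos.2 hN').ne'
  have hsum := Finset.sum_active_eq h.nonneg A P fun _ _ hv => hv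
  obtain ⟨s, hGWBE⟩ := exists_isGWBE (d := N - A.card) (P := P)
    (Finset.univ.filter fun v => v ∉ A ∧ 0 < P v) (fun v hv => (Finset.mem_filter.1 hv).2.2)
    (fun v hv => by
      rw [hsum]
      exact h.le_rest v (Finset.mem_filter.1 hv).2.1)
    -- If no dimension were left, `rest_le` for the first user of `A` would leave no power to the
    -- active users outside `A`.
    (fun hne => by
      by_contra hd
      have hcard := h.card_le
      have hle := h.rest_le ⟨0, by omega⟩
      have hd0 : N - A.card = 0 := by omega
      have := Finset.sum_pos (f := P) (fun v hv => (Finset.mem_filter.1 hv).2.2) hne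
      rw [hsum] at this
      rw [hd0, Nat.cast_zero, zero_mul] at hle
      linarith)
  let φ : Fin A.card ⊕ Fin (N - A.card) ≃ Fin N :=
    finSumFinEquiv.trans (finCongr (Nat.add_sub_of_le h.card_le))
  let U : Matrix (Fin A.card ⊕ Fin (N - A.card)) (Fin N) ℝ :=
    Matrix.of fun j x => if φ j = x then 1 else 0
  have hU : U * U.transpose = 1 := by
    ext j j'
    simp [Matrix.mul_apply, U, Matrix.one_apply, eq_comm]
  have hU' : U.transpose * U = 1 := by
    exact (Matrix.mul_eq_one_comm_of_equiv φ).1 hU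
  let E : Matrix (Fin N) (Fin (N - A.card)) ℝ :=
    Matrix.of fun x a => √(N : ℝ) * U (Sum.inr a) x
  classical
  let S : Matrix (Fin N) (VirtualUser nbar) ℝ := Matrix.of fun x v =>
    if v ∈ A then (if ∃ i, g i = v ∧ φ (Sum.inl i) = x then √(N : ℝ) else 0)
    else E.mulVec (s v) x
  have hSg : ∀ i x, S x (g i) = if φ (Sum.inl i) = x then √(N : ℝ) else 0 := by
    intro i x
    have : ∀ l, g l = g i ↔ l = i := fun l => h.injective.eq_iff
    simp [S, (h.mem_iff (g i)).2 ⟨i, rfl⟩, this]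
  have hUS : ∀ j v, (U * S) j v = S (φ j) v := by
    intro j v
    simp [Matrix.mul_apply, U]
  have hdot : ∀ i i', S.col (g i) ⬝ᵥ S.col (g i') = if i = i' then (N : ℝ) else 0 := by
    intro i i'
    simp only [dotProduct, Matrix.col_apply, hSg]
    by_cases hi : i = i'
    · simp [hi, hs]
    · simp [hi]
  refine ⟨S, fun v hv => ?_, fun v hv w hw hvw => ?_, E, s,
    isComplementBasis_of_orthogonal hN h.mem_iff hU hU' (fun i => ?_) (fun i j hj => ?_),
    fun v hv _ => ?_, ?_⟩
  · obtain ⟨i, rfl⟩ := (h.mem_iff v).1 hv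
    rw [hdot, if_pos rfl]
  · obtain ⟨i, rfl⟩ := (h.mem_iff v).1 hv
    obtain ⟨j, rfl⟩ := (h.mem_iff w).1 hw
    rw [hdot, if_neg fun hij => hvw (congrArg g hij)]
  · rw [hUS, hSg, if_pos rfl]
    exact hs0
  · rw [hUS, hSg, if_neg]
    exact fun h => hj (φ.injective h).symm
  · ext x
    simp [S, hv]
  · convert hGWBE

end Form

/-! ### The classification yields a power split -/

section Numbering

variable {K N : ℕ} {nbar : Fin K → ℕ} {P : VirtualUser nbar → ℝ} {m : ℕ}
  {e : Fin m ≃ {v // 0 < P v}}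

theorem IsPowerNumbering.antitone (he : IsPowerNumbering N P e) (hN : 0 < N) :
    Antitone fun i => P (e i) := by
  have hN' : (0 : ℝ) < N := by exact_mod_cast hN
  intro i j hij
  have := he hij
  simp only at this ⊢
  rwa [div_le_div_iff_of_pos_right (by positivity)] at this

/-- A user is not undersized if and only if its power is at least the average power per dimension
that it and the later users have in the dimensions that the earlier users leave free. -/
theorem not_isUndersized_iff (hN : 0 < N) {q : Fin m → ℝ} (hq : ∀ i, 0 < q i) (i : Fin m) :
    ¬ FDMA.IsUndersized q (fun _ => 1 / (2 * (N : ℝ))) (1 / 2) i ↔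
      ∑ j ∈ Finset.Ici i, q j ≤ (N - (i : ℕ)) * q i := by
  have hN' : (0 : ℝ) < N := by exact_mod_cast hN
  have hT : 0 < ∑ j ∈ Finset.Ici i, q j :=
    Finset.sum_pos (fun j _ => hq j) ⟨i, Finset.mem_Ici.2 le_rfl⟩
  rw [FDMA.IsUndersized, FDMA.dueShare, not_lt, Finset.sum_const, Fin.card_Iio, nsmul_eq_mul]
  generalize ∑ j ∈ Finset.Ici i, q j = T at hT
  have : (1 / 2 - (i : ℕ) * (1 / (2 * (N : ℝ)))) * (q i / T) =
      (N - (i : ℕ)) * q i / (2 * N * T) := by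
    field_simp
  rw [this, div_le_div_iff₀ (by positivity) (by positivity)]
  constructor <;> intro h
  · refine le_of_mul_le_mul_left (a := 2 * (N : ℝ)) ?_ (by positivity)
    linarith
  · have := mul_le_mul_of_nonneg_left h (a := 2 * (N : ℝ)) (by positivity)
    linarith

theorem mem_nonUndersized_iff (hN : 0 < N) {v : VirtualUser nbar} :
    v ∈ nonUndersized N P e ↔ ∃ i : Fin m,
      ∑ j ∈ Finset.Ici i, P (e j) ≤ (N - (i : ℕ)) * P (e i) ∧ (e i : VirtualUser nbar) = v := by
  simp only [nonUndersized, Finset.mem_map, Finset.mem_filter, Finset.mem_univ, true_and]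
  refine exists_congr fun i => and_congr ?_ Iff.rfl
  exact not_isUndersized_iff hN (q := fun j => P (e j)) (fun j => (e j).2) i

/-- Cardinalities decide: an index in `F` brings `Iic i` into `F`, and an index outside confines `F`
to `Iio i`. -/
theorem Fin.mem_iff_lt_card_of_isLowerSet {F : Finset (Fin m)} (hF : IsLowerSet (F : Set (Fin m)))
    (i : Fin m) : i ∈ F ↔ (i : ℕ) < F.card := by
  constructor <;> intro h
  · have : Finset.Iic i ⊆ F := fun j hj => hF (Finset.mem_Iic.1 hj) h
    have := Finset.card_le_card this
    rw [Fin.card_Iic] at this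
    omega
  · by_contra hi
    have : F ⊆ Finset.Iio i := fun j hj => by
      rw [Finset.mem_Iio]
      by_contra hij
      exact hi (hF (not_lt.1 hij) hj)
    have := Finset.card_le_card this
    rw [Fin.card_Iio] at this
    omega

/-- The users that are not undersized form an initial segment of the numbering. -/
theorem exists_isPowerSplit_nonUndersized (hN : 0 < N) (hP : ∀ v, 0 ≤ P v)
    (he : IsPowerNumbering N P e) :
    ∃ g, IsPowerSplit N P (nonUndersized N P e) g := by
  classical
  have hanti := he.antitone hN
  have hpos : ∀ i, 0 < P (e i) := fun i => (e i).2
  let F : Finset (Fin m) := Finset.univ.filter fun i =>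
    ∑ j ∈ Finset.Ici i, P (e j) ≤ (N - (i : ℕ)) * P (e i)
  have hmemF : ∀ i, i ∈ F ↔ ∑ j ∈ Finset.Ici i, P (e j) ≤ (N - (i : ℕ)) * P (e i) := by
    simp [F]
  have hlt : ∀ i ∈ F, (i : ℕ) < N := by
    intro i hi
    have hT : 0 < ∑ j ∈ Finset.Ici i, P (e j) :=
      Finset.sum_pos (fun j _ => hpos j) ⟨i, Finset.mem_Ici.2 le_rfl⟩
    have : 0 < ((N : ℝ) - (i : ℕ)) := pos_of_mul_pos_left (hT.trans_le ((hmemF i).1 hi)) (hpos i).le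
    exact_mod_cast sub_pos.1 this
  -- Split the tail from `i` at `j`: the users from `i` to before `j` have at most (j - i) P i, and
  -- the tail from `j` has at most (N - j) P j ≤ (N - j) P i.
  have hlower : IsLowerSet (F : Set (Fin m)) := by
    intro j i hij hj
    have hjN : ((j : ℕ) : ℝ) < N := by exact_mod_cast hlt j hj
    rw [Finset.mem_coe, hmemF] at hj ⊢
    have hsplit : Finset.Ici i = Finset.Ico i j ∪ Finset.Ici j := by
      ext l
      simp only [Finset.mem_Ici, Finset.mem_union, Finset.mem_Ico]
      constructor
      · intro h
        rcases lt_or_ge l j with h' | h'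
        · exact Or.inl ⟨h, h'⟩
        · exact Or.inr h'
      · rintro (h | h)
        · exact h.1
        · exact hij.trans h
    have hdisj : Disjoint (Finset.Ico i j) (Finset.Ici j) := by
      rw [Finset.disjoint_left]
      intro l hl hl'
      exact absurd (Finset.mem_Ici.1 hl') (not_le.2 (Finset.mem_Ico.1 hl).2)
    have hIco : ∑ l ∈ Finset.Ico i j, P (e l) ≤ (((j : ℕ) : ℝ) - (i : ℕ)) * P (e i) := by
      have := Finset.sum_le_card_nsmul (Finset.Ico i j) (fun l => P (e l)) (P (e i))
        fun l hl => hanti (Finset.mem_Ico.1 hl).1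
      rwa [Fin.card_Ico, nsmul_eq_mul, Nat.cast_sub (by exact_mod_cast hij)] at this
    have hmul : (N - (j : ℕ)) * P (e j) ≤ (N - (j : ℕ)) * P (e i) :=
      mul_le_mul_of_nonneg_left (hanti hij) (by linarith)
    rw [hsplit, Finset.sum_union hdisj]
    linarith
  have hmemA : ∀ i, (e i : VirtualUser nbar) ∈ nonUndersized N P e ↔ i ∈ F := by
    intro i
    rw [mem_nonUndersized_iff hN, hmemF]
    constructor
    · rintro ⟨j, hj, hji⟩
      rwa [e.injective (Subtype.ext hji)] at hj
    · exact fun h => ⟨i, h, rfl⟩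
  have hA : nonUndersized N P e = F.map (e.toEmbedding.trans (Function.Embedding.subtype _)) := by
    ext v
    rw [mem_nonUndersized_iff hN]
    simp [F]
  have hcard : (nonUndersized N P e).card = F.card := by rw [hA, Finset.card_map]
  have hkm : (nonUndersized N P e).card ≤ m := by
    rw [hcard]
    exact (Finset.card_le_univ F).trans_eq (Fintype.card_fin m)
  have hmem : ∀ i : Fin m, i ∈ F ↔ (i : ℕ) < (nonUndersized N P e).card := fun i => by
    rw [hcard, Fin.mem_iff_lt_card_of_isLowerSet hlower]
  have hkN : (nonUndersized N P e).card ≤ N := by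
    by_contra! h
    -- With more than N members, the initial segment would contain the index N, which `hlt`
    -- excludes.
    exact lt_irrefl _ (hlt ⟨N, h.trans_le hkm⟩ ((hmem _).2 h))
  have hrest : ∑ v with v ∉ nonUndersized N P e, P v =
      ∑ i ∈ Finset.univ.filter (fun i : Fin m => (nonUndersized N P e).card ≤ (i : ℕ)), P (e i) := by
    rw [← Finset.sum_active_eq hP _ P fun _ _ hv => hv]
    have : (Finset.univ.filter fun v => v ∉ nonUndersized N P e ∧ 0 < P v) =
        (Finset.univ.filter fun i : Fin m => (nonUndersized N P e).card ≤ (i : ℕ)).map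
          (e.toEmbedding.trans (Function.Embedding.subtype _)) := by
      ext v
      simp only [Finset.mem_filter, Finset.mem_univ, true_and, Finset.mem_map,
        Function.Embedding.trans_apply, Equiv.coe_toEmbedding, Function.Embedding.subtype_apply]
      constructor
      · rintro ⟨hv, hPv⟩
        refine ⟨e.symm ⟨v, hPv⟩, ?_, by simp⟩
        rw [← not_lt, ← hmem, ← hmemA]
        simpa using hv
      · rintro ⟨i, hi, rfl⟩
        rw [← not_lt, ← hmem, ← hmemA] at hi
        exact ⟨hi, hpos i⟩
    rw [this, Finset.sum_map]
    rfl
  refine ⟨fun i => e (Fin.castLE hkm i), ⟨hP, fun i => hpos _, ?_, fun v => ?_, ?_, hkN, ?_, ?_⟩⟩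
  · exact fun i j hij => Fin.castLE_injective hkm (e.injective (Subtype.ext hij))
  · constructor
    · intro hv
      obtain ⟨i, hi, rfl⟩ := (mem_nonUndersized_iff hN).1 hv
      exact ⟨⟨i, (hmem i).1 ((hmemF i).2 hi)⟩, rfl⟩
    · rintro ⟨i, rfl⟩
      exact (hmemA _).2 ((hmem _).2 i.2)
  · exact fun i j hij => hanti (show Fin.castLE hkm i ≤ Fin.castLE hkm j from hij)
  · intro i
    have hk0 : 0 < (nonUndersized N P e).card := i.pos
    -- The last user that is not undersized. Cancelling its own power in P l + rest ≤ (N - |A| + 1)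
    -- P l gives `rest_le` for it, and the earlier users have at least its power.
    let l : Fin m := ⟨(nonUndersized N P e).card - 1, by omega⟩
    have hl := (hmemF l).1 ((hmem l).2 (by simp only [l]; omega))
    have hIci : Finset.Ici l =
        insert l (Finset.univ.filter fun i : Fin m => (nonUndersized N P e).card ≤ (i : ℕ)) := by
      ext j
      simp only [Finset.mem_Ici, Finset.mem_insert, Finset.mem_filter, Finset.mem_univ, true_and,
        Fin.le_def, Fin.ext_iff, l]
      omega
    rw [hIci, Finset.sum_insert (by simp only [Finset.mem_filter, l]; omega), ← hrest] at hl
    have hlval : ((l : ℕ) : ℝ) = (nonUndersized N P e).card - 1 := by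
      simp only [l]
      rw [Nat.cast_sub hk0, Nat.cast_one]
    rw [hlval] at hl
    have hil : P (e l) ≤ P (e (Fin.castLE hkm i)) :=
      hanti (by rw [Fin.le_def]; simp only [l, Fin.val_castLE]; omega)
    have := mul_le_mul_of_nonneg_left hil (Nat.cast_nonneg (N - (nonUndersized N P e).card))
    rw [Nat.cast_sub hkN] at this ⊢
    linarith
  · intro v hv
    rw [Nat.cast_sub hkN]
    rcases (hP v).eq_or_lt with h0 | h0
    · rw [← h0, mul_zero]
      exact Finset.sum_nonneg fun v _ => hP v
    obtain ⟨j, hj⟩ : ∃ j, (e j : VirtualUser nbar) = v := ⟨e.symm ⟨v, h0⟩, by simp⟩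
    have hjk : (nonUndersized N P e).card ≤ (j : ℕ) := by
      rw [← not_lt, ← hmem, ← hmemA, hj]
      exact hv
    -- The first undersized user: its tail is all the remaining power, and no later user has more
    -- power than it.
    let l : Fin m := ⟨(nonUndersized N P e).card, by omega⟩
    have hl : l ∉ F := fun h => lt_irrefl _ ((hmem l).1 h)
    rw [hmemF, not_le] at hl
    have hIci : Finset.Ici l =
        Finset.univ.filter fun i : Fin m => (nonUndersized N P e).card ≤ (i : ℕ) := by
      ext j
      simp [Fin.le_def, l]
    rw [hIci, ← hrest] at hl
    have hjl : P v ≤ P (e l) := by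
      rw [← hj]
      exact hanti (by rw [Fin.le_def]; exact hjk)
    have hkN' : ((nonUndersized N P e).card : ℝ) ≤ N := by exact_mod_cast hkN
    exact (mul_le_mul_of_nonneg_left hjl (sub_nonneg.2 hkN')).trans hl.le

end Numbering

/-! ### Existence of maxima and the joint optimization -/

section Optimality

variable {K N : ℕ} {nbar : Fin K → ℕ} {σ : ℝ} {p : Fin K → ℝ}

theorem one_add_smul_det_pos {P : VirtualUser nbar → ℝ} (hP : ∀ v, 0 ≤ P v)
    (S : Matrix (Fin N) (VirtualUser nbar) ℝ) :
    0 < (1 + (1 / σ ^ 2) • (S * Matrix.diagonal P * S.transpose)).det := by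
  rw [Matrix.smul_mul_diagonal_mul_transpose]
  exact (S.posDef_one_add_mul_diagonal_mul_transpose
    fun v => mul_nonneg (by positivity) (hP v)).det_pos

theorem sumRate_le_sumRate_iff (hN : 0 < N) {P P' : VirtualUser nbar → ℝ} (hP : ∀ v, 0 ≤ P v)
    (hP' : ∀ v, 0 ≤ P' v) (S S' : Matrix (Fin N) (VirtualUser nbar) ℝ) :
    sumRate N σ P S ≤ sumRate N σ P' S' ↔
      (1 + (1 / σ ^ 2) • (S * Matrix.diagonal P * S.transpose)).det ≤
        (1 + (1 / σ ^ 2) • (S' * Matrix.diagonal P' * S'.transpose)).det := by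
  have hN' : (0 : ℝ) < N := by exact_mod_cast hN
  rw [sumRate, sumRate, mul_le_mul_iff_right₀ (by positivity),
    Real.logb_le_logb one_lt_two (one_add_smul_det_pos hP S) (one_add_smul_det_pos hP' S')]

/-- A sequence of squared norm `N`. -/
theorem one_dotProduct_one_eq_card : (1 : Fin N → ℝ) ⬝ᵥ 1 = N := by
  simp [dotProduct]

/-- The columns of inactive users do not affect the sum rate. -/
theorem sumRate_congr {P : VirtualUser nbar → ℝ} (hP : ∀ v, 0 ≤ P v)
    {S S' : Matrix (Fin N) (VirtualUser nbar) ℝ} (h : ∀ v, 0 < P v → S.col v = S'.col v) :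
    sumRate N σ P S = sumRate N σ P S' := by
  have : S * Matrix.diagonal P * S.transpose = S' * Matrix.diagonal P * S'.transpose := by
    ext i j
    rw [Matrix.mul_diagonal_mul_transpose_apply, Matrix.mul_diagonal_mul_transpose_apply]
    refine Finset.sum_congr rfl fun v _ => ?_
    rcases (hP v).eq_or_lt with h0 | h0
    · rw [← h0, zero_mul, zero_mul]
    · have hi : S i v = S' i v := congrFun (h v h0) i
      have hj : S j v = S' j v := congrFun (h v h0) j
      rw [hi, hj]
  rw [sumRate, sumRate, this]

theorem isCompact_setOf_isFeasiblePower :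
    IsCompact {P : VirtualUser nbar → ℝ | IsFeasiblePower p P} := by
  refine (isCompact_univ_pi fun v : VirtualUser nbar =>
    isCompact_Icc (a := 0) (b := p v.1)).of_isClosed_subset ?_ ?_
  · simp only [IsFeasiblePower, Set.ofPred_and, Set.ofPred_forall]
    refine (isClosed_iInter fun k => isClosed_eq (by fun_prop) continuous_const).inter
      (isClosed_iInter fun v => isClosed_le continuous_const (by fun_prop))
  · rintro P ⟨hsum, hnonneg⟩ ⟨k, l⟩ -
    refine ⟨hnonneg _, ?_⟩
    rw [← hsum k]
    exact Finset.single_le_sum (f := fun l => P ⟨k, l⟩) (fun l _ => hnonneg _) (Finset.mem_univ l)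

theorem exists_isFeasiblePower (hnbar : ∀ k, 0 < nbar k) (hp : ∀ k, 0 < p k) :
    ∃ P : VirtualUser nbar → ℝ, IsFeasiblePower p P := by
  refine ⟨fun v => if v.2 = ⟨0, hnbar v.1⟩ then p v.1 else 0, fun k => ?_, fun v => ?_⟩
  · have := Finset.sum_ite_eq' Finset.univ (⟨0, hnbar k⟩ : Fin (nbar k)) fun _ => p k
    simpa only [Finset.mem_univ, if_true] using this
  · simp only
    split_ifs
    · exact (hp _).le
    · exact le_rfl

theorem isCompact_setOf_col_dotProduct_col {ι : Type*} [Finite ι] :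
    IsCompact {S : Matrix (Fin N) ι ℝ | ∀ v, S.col v ⬝ᵥ S.col v = N} := by
  have hbox : IsCompact (Set.univ.pi fun _ : Fin N => Set.univ.pi fun _ : ι =>
      Set.Icc (-(N : ℝ)) N : Set (Matrix (Fin N) ι ℝ)) :=
    isCompact_univ_pi fun _ => isCompact_univ_pi fun _ => isCompact_Icc
  refine hbox.of_isClosed_subset ?_ ?_
  · simp only [Set.ofPred_forall, dotProduct, Matrix.col_apply]
    exact isClosed_iInter fun v => isClosed_eq (by fun_prop) continuous_const
  · intro S hS x _ v _
    have h1 : S x v * S x v ≤ N := by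
      rw [← hS v]
      exact Finset.single_le_sum (f := fun x => S x v * S x v) (fun x _ => mul_self_nonneg _)
        (Finset.mem_univ x)
    have h2 : (1 : ℝ) ≤ N := by exact_mod_cast x.pos
    exact abs_le.1 (abs_le_of_sq_le_sq (by nlinarith) (by linarith))

/-- A power distribution and signature sequences that maximize the sum rate exist. -/
theorem exists_isOptimalSystem (hN : 0 < N) (hnbar : ∀ k, 0 < nbar k) (hp : ∀ k, 0 < p k) :
    ∃ (P : VirtualUser nbar → ℝ) (S : Matrix (Fin N) (VirtualUser nbar) ℝ),
      IsOptimalSystem N σ p P S := by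
  -- Admissibility leaves inactive columns free, so the maximum is taken over matrices all of whose
  -- columns have squared norm N, which form a compact set.
  have hcompact := (isCompact_setOf_isFeasiblePower (nbar := nbar) (p := p)).prod
    (isCompact_setOf_col_dotProduct_col (N := N) (ι := VirtualUser nbar))
  obtain ⟨P₀, hP₀⟩ := exists_isFeasiblePower hnbar hp
  obtain ⟨⟨P, S⟩, ⟨hP, hS⟩, hmax⟩ := hcompact.exists_isMaxOn
    ⟨(P₀, Matrix.of fun _ _ => 1), hP₀, fun _ => one_dotProduct_one_eq_card⟩
    (f := fun x : (VirtualUser nbar → ℝ) × Matrix (Fin N) (VirtualUser nbar) ℝ =>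
      (1 + (1 / σ ^ 2) • (x.2 * Matrix.diagonal x.1 * x.2.transpose)).det)
    (by fun_prop)
  refine ⟨P, S, ⟨hP, fun v _ => hS v⟩, fun P' S' hP' hS' => ?_⟩
  classical
  -- The inactive columns of a competitor become the all-ones vector, of squared norm N, at no
  -- change of the rate.
  let T : Matrix (Fin N) (VirtualUser nbar) ℝ := Matrix.of fun x v => if 0 < P' v then S' x v else 1
  have hT : ∀ v, 0 < P' v → S'.col v = T.col v := by
    intro v hv
    ext x
    simp [T, hv]
  rw [sumRate_congr hP'.2 hT, sumRate_le_sumRate_iff hN hP'.2 hP.2]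
  refine hmax (a := (P', T)) ⟨hP', fun v => ?_⟩
  by_cases hv : 0 < P' v
  · rw [← hT v hv, hS' v hv]
  · have : T.col v = 1 := by
      ext x
      simp [T, hv]
    rw [this, one_dotProduct_one_eq_card]

theorem exists_isAdmissible (P : VirtualUser nbar → ℝ) : ∃ S, IsAdmissible N P S :=
  ⟨Matrix.of fun _ _ => 1, fun _ _ => one_dotProduct_one_eq_card⟩

theorem maxSumRate_le {P : VirtualUser nbar → ℝ} {r : ℝ}
    (h : ∀ S, IsAdmissible N P S → sumRate N σ P S ≤ r) : maxSumRate N σ P ≤ r := by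
  obtain ⟨S, hS⟩ := exists_isAdmissible (N := N) P
  refine csSup_le ⟨_, S, hS, rfl⟩ ?_
  rintro _ ⟨T, hT, rfl⟩
  exact h T hT

/-- A supremum in ℝ is meaningful only for a bounded set; the joint maximum provides the bound. -/
theorem sumRate_le_maxSumRate (hN : 0 < N) (hnbar : ∀ k, 0 < nbar k) (hp : ∀ k, 0 < p k)
    {P : VirtualUser nbar → ℝ} (hP : IsFeasiblePower p P)
    {S : Matrix (Fin N) (VirtualUser nbar) ℝ} (hS : IsAdmissible N P S) :
    sumRate N σ P S ≤ maxSumRate N σ P := by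
  obtain ⟨P₁, S₁, h₁⟩ := exists_isOptimalSystem (σ := σ) hN hnbar hp
  refine le_csSup ⟨sumRate N σ P₁ S₁, ?_⟩ ⟨S, hS, rfl⟩
  rintro _ ⟨T, hT, rfl⟩
  exact h₁.2 P T hP hT

end Optimality

theorem theorem4 {K N : ℕ} (hN : 0 < N) (nbar : Fin K → ℕ) (hnbar : ∀ k, 0 < nbar k)
    (p : Fin K → ℝ) (hp : ∀ k, 0 < p k) (σ : ℝ) (hσ : 0 < σ) :
    (∃ P : VirtualUser nbar → ℝ, IsOptimalPower N σ p P) ∧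
    ∀ P : VirtualUser nbar → ℝ, IsOptimalPower N σ p P →
      ∀ (m : ℕ) (e : Fin m ≃ {v // 0 < P v}), IsPowerNumbering N P e →
        (nonUndersized N P e).card ≤ N ∧
        (∃ S : Matrix (Fin N) (VirtualUser nbar) ℝ,
          IsOrthogonalGWBE N P (nonUndersized N P e) S) ∧
        ∀ S : Matrix (Fin N) (VirtualUser nbar) ℝ,
          IsOptimalSystem N σ p P S ↔ IsOrthogonalGWBE N P (nonUndersized N P e) S := by
  refine ⟨?_, fun P hP m e he => ?_⟩
  · obtain ⟨P, S, ⟨hP, hS⟩, hmax⟩ := exists_isOptimalSystem (σ := σ) hN hnbar hp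
    exact ⟨P, hP, fun P' hP' => (maxSumRate_le fun S' hS' => hmax P' S' hP' hS').trans
      (sumRate_le_maxSumRate hN hnbar hp hP hS)⟩
  obtain ⟨g, hg⟩ := exists_isPowerSplit_nonUndersized hN hP.1.2 he
  obtain ⟨S₀, hS₀⟩ := hg.exists_isOrthogonalGWBE hN
  refine ⟨hg.card_le, ⟨S₀, hS₀⟩, fun S => ⟨fun hS => ?_, fun hS => ?_⟩⟩
  · obtain ⟨hadm₀, hdet₀⟩ := hS₀.isAdmissible_and_det_eq (σ := σ) hg hN
    obtain ⟨hle, heq⟩ := hg.det_le hN hσ hS.1.2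
    -- Comparison with `S₀`, which attains the bound for the same powers, forces equality in the
    -- determinant bound.
    have := (sumRate_le_sumRate_iff hN hP.1.2 hP.1.2 _ _).1 (hS.2 P S₀ hP.1 hadm₀)
    exact heq (le_antisymm hle (hdet₀ ▸ this))
  · obtain ⟨hadm, hdet⟩ := hS.isAdmissible_and_det_eq (σ := σ) hg hN
    refine ⟨⟨hP.1, hadm⟩, fun P' S' hP' hS' => ?_⟩
    -- Optimality of `P` reduces any competitor `(P', S')` to competitors with powers `P`, where the
    -- determinant bound is attained by `S`.
    refine (sumRate_le_maxSumRate hN hnbar hp hP' hS').trans ((hP.2 P' hP').trans ?_)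
    refine maxSumRate_le fun T hT => ?_
    rw [sumRate_le_sumRate_iff hN hP.1.2 hP.1.2, hdet]
    exact (hg.det_le hN hσ hT).1
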